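/- Let $Q\in\mathcal D'(\mathbb R)$ be a complex-valued distribution, and for $u\in C_0^\infty(\mathbb R)$ (complex-valued) write $\langle Qu,u\rangle=\langle Q,|u|^2\rangle$. Put $\|u\|_{W^{1,2}}=\|u\|_{L^2}+\|u'\|_{L^2}$. The following statements are equivalent. (i) $Q$ is infinitesimally form bounded with respect to $-\frac{d^2}{dx^2}$: for every $\epsilon>0$ there is $C(\epsilon)>0$ such that $$|\langle Qu,u\rangle|\le \epsilon\,\|u'\|_{L^2(\mathbb R)}^2+C(\epsilon)\,\|u\|_{L^2(\mathbb R)}^2\qquad\text{for all }u\in C_0^\infty(\mathbb R).$$ (ii) $Q$ is form bounded with respect to $-\frac{d^2}{dx^2}$: there is a constant $C$ such that $$|\langle Qu,u\rangle|\le C\,\|u\|_{W^{1,2}(\mathbb R)}^2\qquad\text{for all }u\in C_0^\infty(\mathbb R).$$ (iii) There are complex-valued functions $\Gamma\in L^2_{\rm loc}(\mathbb R)$ and $\gamma\in L^1_{\rm loc}(\mathbb R)$ such that $Q=\frac{d\Gamma}{dx}+\gamma$ in the sense of distributions and $$\sup_{x\in\mathbb R}\int_x^{x+1}\bigl(|\Gamma(t)|^2+|\gamma(t)|\bigr)\,dt<+\infty.\qquad(*)$$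 (iv) The convolutions $$\Gamma(x)=\int_{\mathbb R}\operatorname{sign}(x-t)\,e^{-|x-t|}\,Q(t)\,dt,\qquad \gamma(x)=\int_{\mathbb R}e^{-|x-t|}\,Q(t)\,dt$$ exist in the distributional sense, are (given by) locally integrable functions, and satisfy $(*)$. Here, for a locally integrable kernel $k$, the convolution $T(x)=\int k(x-t)\,Q(t)\,dt$ exists in the distributional sense and equals $T\in\mathcal D'(\mathbb R)$ if, for every test function $\varphi$, $\langle T,\varphi\rangle=\lim_{n\to\infty}\langle Q,\eta_n\,\psi\rangle$, where $\psi(t)=\int k(x-t)\varphi(x)\,dx$, for every sequence $\eta_n\in C_0^\infty(\mathbb R)$ of real-valued functions such that for each $m\ge0$ the derivatives $\eta_n^{(m)}$ are bounded uniformly in $n$ and $x$, and for each compact $K$ one has $\eta_n=1$ on $K$ for all large $n$. -/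

import Mathlib

open MeasureTheory Filter Topology TopologicalSpace
open scoped Distributions LineDeriv ContDiff

noncomputable section

namespace FormBoundedness

/-- Complex-valued test functions `C_c^∞(ℝ; ℂ)`. -/
abbrev ComplexTest := 𝓓((⊤ : Opens ℝ), ℂ)

/-- Real-valued test functions `C_c^∞(ℝ; ℝ)`. -/
abbrev RealTest := 𝓓((⊤ : Opens ℝ), ℝ)

/-- Complex-valued distributions on `ℝ`. -/
abbrev Distr := 𝓓'((⊤ : Opens ℝ), ℂ)

/-- The test function `|u|²`. -/
def absSq (u : ComplexTest) : RealTest where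
  toFun x := ‖u x‖ ^ 2
  contDiff' := u.contDiff.norm_sq ℝ
  hasCompactSupport' :=
    u.hasCompactSupport.comp_left (g := fun z : ℂ => ‖z‖ ^ 2) (by simp)
  tsupport_subset' := fun _ _ => trivial

/-- The quadratic form `⟨Q u, u⟩ = ⟨Q, |u|²⟩`. -/
def quadForm (Q : Distr) (u : ComplexTest) : ℂ := Q (absSq u)

/-- The norm of `L²(ℝ)` (used for test functions and their derivatives only). -/
def l2Norm (f : ℝ → ℂ) : ℝ := (eLpNorm f 2 volume).toReal

/-- The norm of `W^{1,2}(ℝ)`, for test functions. -/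
def w12Norm (u : ComplexTest) : ℝ := l2Norm u + l2Norm (deriv u)

/-- `Q` is infinitesimally form bounded with respect to `-d²/dx²`. -/
def InfinitesimallyFormBounded (Q : Distr) : Prop :=
  ∀ ε : ℝ, 0 < ε → ∃ C : ℝ, 0 < C ∧ ∀ u : ComplexTest,
    ‖quadForm Q u‖ ≤ ε * l2Norm (deriv u) ^ 2 + C * l2Norm u ^ 2

/-- `Q` is form bounded with respect to `-d²/dx²`. -/
def FormBounded (Q : Distr) : Prop :=
  ∃ C : ℝ, ∀ u : ComplexTest, ‖quadForm Q u‖ ≤ C * w12Norm u ^ 2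

/-- The distribution `φ ↦ ∫ φ f` defined by a locally integrable function `f`. -/
def ofFun (f : ℝ → ℂ) : Distr where
  toFun φ := TestFunction.integralAgainstBilinCLM (ContinuousLinearMap.lsmul ℝ ℝ) volume f φ
  map_add' φ ψ := map_add _ φ ψ
  map_smul' c φ := map_smul _ c φ
  cont := (TestFunction.integralAgainstBilinCLM (Ω := (⊤ : Opens ℝ)) (n := ⊤)
    (ContinuousLinearMap.lsmul ℝ ℝ) volume f).continuous

theorem ofFun_apply {f : ℝ → ℂ} (hf : LocallyIntegrable f volume) (φ : RealTest) :
    ofFun f φ = ∫ x, φ x • f x :=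
  TestFunction.integralAgainstBilinCLM_eq_integral (hf.locallyIntegrableOn _)

/-- `sup_x ∫_x^{x+1} (|Γ|² + |γ|) < ∞`, for (locally integrable) functions `Γ`, `γ`. -/
def UniformBound (Γ γ : ℝ → ℂ) : Prop :=
  LocallyIntegrable Γ volume ∧ LocallyIntegrable γ volume ∧
    (⨆ x : ℝ, ∫⁻ t in Set.Icc x (x + 1), (‖Γ t‖ₑ ^ 2 + ‖γ t‖ₑ)) < ⊤

/-- An approximate unit: test functions `η n` which are bounded uniformly in `n` together with
each of their derivatives, and equal to `1` on any given compact set for all large `n`. -/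
def IsApproxUnit (η : ℕ → RealTest) : Prop :=
  (∀ m : ℕ, ∃ C : ℝ, ∀ (n : ℕ) (x : ℝ), |iteratedDeriv m (η n) x| ≤ C) ∧
    ∀ K : Set ℝ, IsCompact K → ∀ᶠ n in atTop, ∀ x ∈ K, η n x = 1

theorem contDiff_reflConv {k : ℝ → ℝ} (hk : LocallyIntegrable k volume) (φ : RealTest) :
    ContDiff ℝ ∞ (fun t => ∫ x, k (x - t) * φ x) := by
  have hk' : LocallyIntegrable (fun s => k (-s)) volume := by
    have h := hk
    rw [← (Measure.IsNegInvariant.neg_eq_self : (volume : Measure ℝ).neg = volume)] at h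
    exact (MeasureTheory.locallyIntegrable_map_homeomorph (Homeomorph.neg ℝ)).1 h
  have h := φ.hasCompactSupport.contDiff_convolution_right (ContinuousLinearMap.mul ℝ ℝ)
    hk' φ.contDiff
  convert h using 1
  ext t
  rw [convolution_def, ← integral_sub_left_eq_self _ volume t]
  simp

/-- The test function `t ↦ η(t) ∫ k(x - t) φ(x) dx`. -/
def cutoffConv {k : ℝ → ℝ} (hk : LocallyIntegrable k volume) (η φ : RealTest) : RealTest where
  toFun t := η t * ∫ x, k (x - t) * φ x
  contDiff' := η.contDiff.mul (contDiff_reflConv hk φ)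
  hasCompactSupport' := η.hasCompactSupport.mul_right
  tsupport_subset' := fun _ _ => trivial

/-- The convolution `x ↦ ∫ k(x - t) Q(t) dt` of the function `k` and the distribution `Q` exists
in the distributional sense and is the distribution `T`: for every test function `φ`,
`⟨T, φ⟩ = ⟨Q(t), ∫ k(x - t) φ(x) dx⟩`, where the right-hand side, the pairing of `Q` with
a smooth function, is the common limit along all approximate units. -/
def IsConvolution (Q : Distr) {k : ℝ → ℝ} (hk : LocallyIntegrable k volume) (T : Distr) : Prop :=
  ∀ φ : RealTest, ∀ η : ℕ → RealTest, IsApproxUnit η →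
    Tendsto (fun n => Q (cutoffConv hk (η n) φ)) atTop (𝓝 (T φ))

/-- The kernel `e^{-|x|}`. -/
def expKernel (x : ℝ) : ℝ := Real.exp (-|x|)

/-- The kernel `sign(x) e^{-|x|}`. -/
def signKernel (x : ℝ) : ℝ := Real.sign x * Real.exp (-|x|)

theorem locallyIntegrable_expKernel : LocallyIntegrable expKernel volume := by
  have : Continuous expKernel := by unfold expKernel; fun_prop
  exact this.locallyIntegrable

theorem locallyIntegrable_signKernel : LocallyIntegrable signKernel volume := by
  refine locallyIntegrable_expKernel.mono ?_ (ae_of_all _ fun x => ?_)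
  · have : Measurable signKernel := by
      have h : Measurable Real.sign := by
        unfold Real.sign
        exact Measurable.ite measurableSet_Iio measurable_const
          (Measurable.ite measurableSet_Ioi measurable_const measurable_const)
      unfold signKernel
      exact h.mul (by fun_prop)
    exact this.aestronglyMeasurable
  · unfold signKernel expKernel
    rw [norm_mul]
    have : ‖Real.sign x‖ ≤ 1 := by
      rcases Real.sign_apply_eq x with h | h | h <;> simp [h]
    exact mul_le_of_le_one_left (norm_nonneg _) this

end FormBoundedness

end

/-! (i) ⇒ (ii): take ε = 1.

(iii) ⇒ (i): a test function h ≥ 0 satisfies h(t) ≤ ∫_t^{t+1} (h + |h'|), so a weight w of mass at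
most M on every unit interval obeys ∫ w h ≤ M ∫ (h + |h'|) (`lintegral_weight_mul_test_le`). This is
used with h = |u|² and w = |Γ|² or |γ|. Since |h'| ≤ 2|u||u'|, the weighted inequality 2ab ≤ δb² +
a²/δ makes the coefficient of ‖u'‖² as small as desired.

(ii) ⇒ (iii): polarization turns the bound on Q(φ²) into |Q(θψ)| ≤ K‖θ‖‖ψ‖ with W^{1,2} norms
(`norm_mulTest_sq_le`). Let χ_n be a smooth partition of unity by translates. Choosing θ = 1 on the
support of χ_n bounds φ ↦ Q(χ_n φ) by the W^{1,2} norm on [n - 1, n + 1), uniformly in n. The Riesz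
theorem (`exists_representation`) gives a_n, b_n in L² of that interval with Q(χ_n φ) = ∫ (φ a_n +
φ' b_n). Summing over n, γ = ∑ a_n and Γ = -∑ b_n.

(iii) ⇔ (iv): the kernels E = e^{-|x|} and S = sign(x) e^{-|x|} satisfy E' = -S and S' = 2δ₀ - E.
For Q = Γ' + γ this gives S∗Q = 2Γ - E∗Γ + S∗γ and E∗Q = -S∗Γ + E∗γ, where all terms except 2Γ are
bounded functions (`enorm_kernelConv_le`). Conversely 2Q = (S∗Q)' + E∗Q, so half of each convolution
serves as Γ and γ (`eq_of_isConvolution`). -/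

noncomputable section

namespace FormBoundedness

/-! ### Test functions, pairings and L² norms -/

/-- The product of two real test functions. -/
def mulTest (φ ψ : RealTest) : RealTest where
  toFun x := φ x * ψ x
  contDiff' := φ.contDiff.mul ψ.contDiff
  hasCompactSupport' := φ.hasCompactSupport.mul_right
  tsupport_subset' := fun _ _ => trivial

@[simp] theorem mulTest_apply (φ ψ : RealTest) (x : ℝ) : mulTest φ ψ x = φ x * ψ x := rfl

@[simp] theorem absSq_apply (u : ComplexTest) (x : ℝ) : absSq u x = ‖u x‖ ^ 2 := rfl

/-- A real test function, seen as a complex one. -/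
def toComplex (φ : RealTest) : ComplexTest where
  toFun x := (φ x : ℂ)
  contDiff' := Complex.ofRealCLM.contDiff.comp φ.contDiff
  hasCompactSupport' := φ.hasCompactSupport.comp_left (g := fun x : ℝ => (x : ℂ)) (by simp)
  tsupport_subset' := fun _ _ => trivial

@[simp] theorem toComplex_apply (φ : RealTest) (x : ℝ) : toComplex φ x = (φ x : ℂ) := rfl

theorem test_differentiable {F : Type*} [NormedAddCommGroup F] [NormedSpace ℝ F]
    (φ : 𝓓((⊤ : Opens ℝ), F)) : Differentiable ℝ φ :=
  φ.contDiff.differentiable (by simp)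

theorem test_hasDerivAt {F : Type*} [NormedAddCommGroup F] [NormedSpace ℝ F]
    (φ : 𝓓((⊤ : Opens ℝ), F)) (x : ℝ) : HasDerivAt φ (deriv φ x) x :=
  (test_differentiable φ x).hasDerivAt

theorem test_continuous_deriv {F : Type*} [NormedAddCommGroup F] [NormedSpace ℝ F]
    (φ : 𝓓((⊤ : Opens ℝ), F)) : Continuous (deriv φ) :=
  φ.contDiff.continuous_deriv (by simp)

theorem lineDeriv_test (φ : RealTest) (x : ℝ) : (∂_{(1 : ℝ)} φ : RealTest) x = deriv φ x := by
  rw [TestFunction.lineDerivOp_eq_lineDerivCLM (𝕜 := ℝ),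
    TestFunction.lineDerivCLM_apply_of_le (by simp)]
  simp [lineDeriv, deriv_comp_const_add]

theorem coe_lineDeriv_test (φ : RealTest) : ⇑(∂_{(1 : ℝ)} φ : RealTest) = deriv φ :=
  funext (lineDeriv_test φ)

theorem test_smul_integrable {f : ℝ → ℂ} (hf : LocallyIntegrable f volume) (φ : RealTest) :
    Integrable (fun x => φ x • f x) :=
  hf.integrable_smul_left_of_hasCompactSupport φ.continuous φ.hasCompactSupport

theorem deriv_ofFun_add_apply {Γ γ : ℝ → ℂ} (hΓ : LocallyIntegrable Γ volume)
    (hγ : LocallyIntegrable γ volume) (φ : RealTest) :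
    (∂_{(1 : ℝ)} (ofFun Γ) + ofFun γ : Distr) φ =
      -(∫ x, deriv φ x • Γ x) + ∫ x, φ x • γ x := by
  change (∂_{(1 : ℝ)} (ofFun Γ) : Distr) φ + ofFun γ φ = _
  rw [Distribution.lineDerivOp_apply_apply, map_neg, ofFun_apply hΓ, ofFun_apply hγ,
    coe_lineDeriv_test]

theorem l2Norm_sq {f : ℝ → ℂ} (hf : Continuous f) (hc : HasCompactSupport f) :
    l2Norm f ^ 2 = ∫ x, ‖f x‖ ^ 2 := by
  have hm : MemLp f 2 volume := hf.memLp_of_hasCompactSupport hc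
  have h := hm.eLpNorm_eq_integral_rpow_norm (by simp) (by simp)
  have h0 : 0 ≤ ∫ x, ‖f x‖ ^ 2 := integral_nonneg fun x => by positivity
  unfold l2Norm
  rw [h, ENNReal.toReal_ofReal (by positivity)]
  simp only [ENNReal.toReal_ofNat, Real.rpow_ofNat]
  rw [← one_div, ← Real.sqrt_eq_rpow, Real.sq_sqrt h0]

theorem l2Norm_test_sq (u : ComplexTest) : l2Norm u ^ 2 = ∫ x, ‖u x‖ ^ 2 :=
  l2Norm_sq u.continuous u.hasCompactSupport

theorem l2Norm_deriv_sq (u : ComplexTest) : l2Norm (deriv u) ^ 2 = ∫ x, ‖deriv u x‖ ^ 2 :=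
  l2Norm_sq (test_continuous_deriv u) u.hasCompactSupport.deriv

theorem l2Norm_nonneg (f : ℝ → ℂ) : 0 ≤ l2Norm f := ENNReal.toReal_nonneg

theorem InfinitesimallyFormBounded.formBounded {Q : Distr} (h : InfinitesimallyFormBounded Q) :
    FormBounded Q := by
  obtain ⟨C, hC, h⟩ := h 1 one_pos
  refine ⟨1 + C, fun u => (h u).trans ?_⟩
  have h1 := l2Norm_nonneg u
  have h2 := l2Norm_nonneg (deriv u)
  unfold w12Norm
  have h3 := mul_nonneg h1 h2
  nlinarith [mul_nonneg hC.le h3, mul_nonneg hC.le (sq_nonneg (l2Norm (deriv u))),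
    sq_nonneg (l2Norm u)]

/-! ### Uniform local bounds imply infinitesimal form boundedness -/

/-- If a weight has uniformly bounded mass on unit intervals, then its integral against a function
which is dominated by unit averages of `g` is controlled by the integral of `g`. -/
theorem lintegral_mul_le_of_le_average {w h g : ℝ → ENNReal} (hw : AEMeasurable w)
    (hg : Measurable g) {M : ENNReal} (hM : ∀ x, ∫⁻ t in Set.Icc x (x + 1), w t ≤ M)
    (hh : ∀ t, h t ≤ ∫⁻ s in Set.Icc t (t + 1), g s) :
    ∫⁻ t, w t * h t ≤ M * ∫⁻ s, g s := by
  have hS : MeasurableSet {p : ℝ × ℝ | p.1 ≤ p.2 ∧ p.2 ≤ p.1 + 1} :=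
    (measurableSet_le measurable_fst measurable_snd).inter
      (measurableSet_le measurable_snd (measurable_fst.add_const 1))
  have hmeas : AEMeasurable (Function.uncurry fun t s : ℝ =>
      w t * ({p : ℝ × ℝ | p.1 ≤ p.2 ∧ p.2 ≤ p.1 + 1}.indicator (fun p => g p.2) (t, s)))
      (volume.prod volume) :=
    (hw.comp_fst).mul ((hg.comp measurable_snd).indicator hS).aemeasurable
  calc ∫⁻ t, w t * h t
      ≤ ∫⁻ t, ∫⁻ s, w t *
          ({p : ℝ × ℝ | p.1 ≤ p.2 ∧ p.2 ≤ p.1 + 1}.indicator (fun p => g p.2) (t, s)) := by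
        refine lintegral_mono fun t => ?_
        rw [lintegral_const_mul]
        · refine mul_le_mul_right ((hh t).trans_eq ?_) _
          rw [← lintegral_indicator measurableSet_Icc]
          rfl
        · exact (((hg.comp measurable_snd).indicator hS).comp measurable_prodMk_left)
    _ = ∫⁻ s, ∫⁻ t, w t *
          ({p : ℝ × ℝ | p.1 ≤ p.2 ∧ p.2 ≤ p.1 + 1}.indicator (fun p => g p.2) (t, s)) :=
        lintegral_lintegral_swap hmeas
    -- For fixed s the condition t ≤ s ≤ t + 1 cuts out [s - 1, s], written so that `hM` applies at
    -- s - 1.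
    _ = ∫⁻ s, (∫⁻ t in Set.Icc (s - 1) (s - 1 + 1), w t) * g s := by
        refine lintegral_congr fun s => ?_
        rw [← lintegral_mul_const'' _ hw.restrict, ← lintegral_indicator measurableSet_Icc]
        refine lintegral_congr fun t => ?_
        by_cases ht : t ≤ s ∧ s ≤ t + 1
        · rw [Set.indicator_of_mem (by exact ht), Set.indicator_of_mem]
          constructor <;> linarith [ht.1, ht.2]
        · rw [Set.indicator_of_notMem (by exact ht), Set.indicator_of_notMem, mul_zero]
          intro h'
          exact ht ⟨by linarith [h'.2], by linarith [h'.1]⟩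
    _ ≤ M * ∫⁻ s, g s := by
        rw [← lintegral_const_mul _ hg]
        exact lintegral_mono fun s => mul_le_mul_left (hM _) _

/-- By the fundamental theorem of calculus h(t) ≤ h(s) + ∫_t^{t+1} |h'| for each s in [t, t + 1];
averaging over s gives the claim. -/
theorem le_integral_unit_interval {h : ℝ → ℝ} (hd : Differentiable ℝ h)
    (hc : Continuous (deriv h)) (t : ℝ) :
    h t ≤ ∫ s in t..t + 1, (h s + |deriv h s|) := by
  have hi : ∀ a b, IntervalIntegrable (fun s => |deriv h s|) volume a b :=
    fun a b => hc.abs.intervalIntegrable a b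
  have key : ∀ s ∈ Set.Icc t (t + 1), h t - ∫ r in t..t + 1, |deriv h r| ≤ h s := by
    intro s hs
    have h1 : ∫ r in t..s, deriv h r = h s - h t :=
      intervalIntegral.integral_deriv_eq_sub (fun x _ => hd x) (hc.intervalIntegrable _ _)
    have h2 : |∫ r in t..s, deriv h r| ≤ ∫ r in t..s, |deriv h r| :=
      intervalIntegral.abs_integral_le_integral_abs hs.1
    have h3 : ∫ r in t..s, |deriv h r| ≤ ∫ r in t..t + 1, |deriv h r| :=
      intervalIntegral.integral_mono_interval le_rfl hs.1 hs.2
        (ae_of_all _ fun _ => abs_nonneg _) (hi _ _)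
    have h4 := (abs_le.1 h2).1
    linarith
  have h5 := intervalIntegral.integral_mono_on (a := t) (b := t + 1) (by linarith)
    (continuous_const.intervalIntegrable (μ := volume) _ _)
    (hd.continuous.intervalIntegrable (μ := volume) _ _) key
  rw [intervalIntegral.integral_const] at h5
  rw [intervalIntegral.integral_add (hd.continuous.intervalIntegrable _ _) (hi _ _)]
  simp only [add_sub_cancel_left, one_smul] at h5
  linarith

/-- A weight with uniformly bounded mass on unit intervals integrates nonnegative test functions
with a bound by the `W^{1,1}` norm. -/
theorem lintegral_weight_mul_test_le {w : ℝ → ENNReal} (hw : AEMeasurable w) {M : ENNReal}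
    (hM : ∀ x, ∫⁻ t in Set.Icc x (x + 1), w t ≤ M) (h : RealTest) (h0 : ∀ x, 0 ≤ h x) :
    ∫⁻ t, w t * ENNReal.ofReal (h t) ≤ M * ENNReal.ofReal (∫ s, (h s + |deriv h s|)) := by
  have hcont : Continuous fun s => h s + |deriv h s| :=
    h.continuous.add (test_continuous_deriv h).abs
  have hpos : ∀ s, 0 ≤ h s + |deriv h s| := fun s => add_nonneg (h0 s) (abs_nonneg _)
  have hint : Integrable fun s => h s + |deriv h s| :=
    (h.continuous.integrable_of_hasCompactSupport h.hasCompactSupport).add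
      ((test_continuous_deriv h).integrable_of_hasCompactSupport
        h.hasCompactSupport.deriv).abs
  rw [ofReal_integral_eq_lintegral_ofReal hint (ae_of_all _ hpos)]
  refine lintegral_mul_le_of_le_average hw hcont.measurable.ennreal_ofReal hM
    fun t => ?_
  rw [← ofReal_integral_eq_lintegral_ofReal hint.integrableOn (ae_of_all _ hpos)]
  refine ENNReal.ofReal_le_ofReal ((le_integral_unit_interval (test_differentiable h)
    (test_continuous_deriv h) t).trans_eq ?_)
  rw [intervalIntegral.integral_of_le (by linarith), integral_Icc_eq_integral_Ioc]

theorem abs_deriv_absSq_le (u : ComplexTest) (x : ℝ) :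
    |deriv (absSq u) x| ≤ 2 * (‖u x‖ * ‖deriv u x‖) := by
  have h : HasDerivAt (absSq u) (2 * inner ℝ (u x) (deriv u x)) x :=
    (test_hasDerivAt u x).norm_sq
  rw [h.deriv, abs_mul, abs_two]
  exact mul_le_mul_of_nonneg_left (abs_real_inner_le_norm _ _) two_pos.le

theorem UniformBound.exists_bound {Γ γ : ℝ → ℂ} (h : UniformBound Γ γ) :
    ∃ M : ℝ, 0 ≤ M ∧ (∀ x, ∫⁻ t in Set.Icc x (x + 1), ‖Γ t‖ₑ ^ 2 ≤ ENNReal.ofReal M) ∧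
      ∀ x, ∫⁻ t in Set.Icc x (x + 1), ‖γ t‖ₑ ≤ ENNReal.ofReal M := by
  obtain ⟨-, -, h⟩ := h
  refine ⟨(⨆ x : ℝ, ∫⁻ t in Set.Icc x (x + 1), (‖Γ t‖ₑ ^ 2 + ‖γ t‖ₑ)).toReal,
    ENNReal.toReal_nonneg, ?_, ?_⟩ <;> rw [ENNReal.ofReal_toReal h.ne] <;> intro x
  · exact (lintegral_mono fun t => le_self_add).trans (le_iSup
      (fun x : ℝ => ∫⁻ t in Set.Icc x (x + 1), (‖Γ t‖ₑ ^ 2 + ‖γ t‖ₑ)) x)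
  · exact (lintegral_mono fun t => le_add_self).trans (le_iSup
      (fun x : ℝ => ∫⁻ t in Set.Icc x (x + 1), (‖Γ t‖ₑ ^ 2 + ‖γ t‖ₑ)) x)

theorem norm_integral_le_of_lintegral_le {f : ℝ → ℂ} {R : ℝ} (hR : 0 ≤ R)
    (h : ∫⁻ x, ‖f x‖ₑ ≤ ENNReal.ofReal R) : ‖∫ x, f x‖ ≤ R := by
  have h1 := (enorm_integral_le_lintegral_enorm f).trans h
  rw [← ofReal_norm] at h1
  exact (ENNReal.ofReal_le_ofReal_iff hR).1 h1

theorem test_sq_integrable (u : ComplexTest) : Integrable fun x => ‖u x‖ ^ 2 :=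
  (absSq u).continuous.integrable_of_hasCompactSupport (absSq u).hasCompactSupport

theorem test_deriv_sq_integrable (u : ComplexTest) : Integrable fun x => ‖deriv u x‖ ^ 2 :=
  ((test_continuous_deriv u).memLp_of_hasCompactSupport
    u.hasCompactSupport.deriv).integrable_norm_pow two_ne_zero

theorem two_mul_le_weighted {a b δ : ℝ} (hδ : 0 < δ) :
    2 * (a * b) ≤ δ * b ^ 2 + δ⁻¹ * a ^ 2 := by
  have h : δ * b ^ 2 + δ⁻¹ * a ^ 2 - 2 * (a * b) = δ * (b - δ⁻¹ * a) ^ 2 := by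
    field_simp
    ring
  nlinarith [mul_nonneg hδ.le (sq_nonneg (b - δ⁻¹ * a))]

theorem integral_absSq_add_abs_deriv_le (u : ComplexTest) {δ : ℝ} (hδ : 0 < δ) :
    ∫ s, (absSq u s + |deriv (absSq u) s|) ≤
      δ * (∫ x, ‖deriv u x‖ ^ 2) + (1 + δ⁻¹) * ∫ x, ‖u x‖ ^ 2 := by
  rw [← integral_const_mul, ← integral_const_mul, ← integral_add
    ((test_deriv_sq_integrable u).const_mul _) ((test_sq_integrable u).const_mul _)]
  refine integral_mono ?_ (((test_deriv_sq_integrable u).const_mul _).add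
    ((test_sq_integrable u).const_mul _)) fun s => ?_
  · exact (test_sq_integrable u).add ((test_continuous_deriv
      (absSq u)).integrable_of_hasCompactSupport (absSq u).hasCompactSupport.deriv).abs
  · have h1 := abs_deriv_absSq_le u s
    have h2 := two_mul_le_weighted (a := ‖u s‖) (b := ‖deriv u s‖) hδ
    simp only [absSq_apply]
    linarith

/-- Pointwise, 2|u||Γ||u'| ≤ δ|u'|² + δ⁻¹|Γ|²|u|². The last term is |u|² against the weight |Γ|²,
whose mass on unit intervals is bounded. -/
theorem norm_integral_deriv_absSq_smul_le {Γ : ℝ → ℂ} (hΓ : LocallyIntegrable Γ volume)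
    {M : ℝ} (hM0 : 0 ≤ M)
    (hM : ∀ x, ∫⁻ t in Set.Icc x (x + 1), ‖Γ t‖ₑ ^ 2 ≤ ENNReal.ofReal M) (u : ComplexTest)
    {δ : ℝ} (hδ : 0 < δ) :
    ‖∫ x, deriv (absSq u) x • Γ x‖ ≤ δ * (∫ x, ‖deriv u x‖ ^ 2) +
      δ⁻¹ * (M * ∫ s, (absSq u s + |deriv (absSq u) s|)) := by
  have hW : 0 ≤ ∫ s, (absSq u s + |deriv (absSq u) s|) :=
    integral_nonneg fun s => add_nonneg (sq_nonneg _) (abs_nonneg _)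
  have hD : 0 ≤ ∫ x, ‖deriv u x‖ ^ 2 := integral_nonneg fun x => sq_nonneg _
  have hΓm : AEMeasurable (fun t => ‖Γ t‖ₑ ^ 2) volume :=
    hΓ.aestronglyMeasurable.enorm.pow_const 2
  refine norm_integral_le_of_lintegral_le (by positivity) ?_
  calc ∫⁻ x, ‖deriv (absSq u) x • Γ x‖ₑ
      ≤ ∫⁻ x, (ENNReal.ofReal (δ * ‖deriv u x‖ ^ 2) +
          ENNReal.ofReal δ⁻¹ * (‖Γ x‖ₑ ^ 2 * ENNReal.ofReal (absSq u x))) := by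
        refine lintegral_mono fun x => ?_
        rw [← ofReal_norm, ← ofReal_norm, ← ENNReal.ofReal_pow (norm_nonneg _),
          ← ENNReal.ofReal_mul (by positivity), ← ENNReal.ofReal_mul (by positivity),
          ← ENNReal.ofReal_add (by positivity) (by simp only [absSq_apply]; positivity)]
        refine ENNReal.ofReal_le_ofReal ?_
        rw [norm_smul, Real.norm_eq_abs, absSq_apply]
        have h1 := mul_le_mul_of_nonneg_right (abs_deriv_absSq_le u x) (norm_nonneg (Γ x))
        have h2 := two_mul_le_weighted (a := ‖u x‖ * ‖Γ x‖) (b := ‖deriv u x‖) hδ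
        calc _ ≤ _ := h1
          _ = 2 * (‖u x‖ * ‖Γ x‖ * ‖deriv u x‖) := by ring
          _ ≤ _ := h2
          _ = _ := by ring
    _ = ENNReal.ofReal (δ * ∫ x, ‖deriv u x‖ ^ 2) +
          ENNReal.ofReal δ⁻¹ * ∫⁻ x, ‖Γ x‖ₑ ^ 2 * ENNReal.ofReal (absSq u x) := by
        rw [lintegral_add_left, lintegral_const_mul', ← integral_const_mul,
          ofReal_integral_eq_lintegral_ofReal ((test_deriv_sq_integrable u).const_mul _)
            (ae_of_all _ fun x => by positivity)]
        · exact ENNReal.ofReal_ne_top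
        · exact (((test_continuous_deriv u).norm.pow 2).const_mul δ).measurable.ennreal_ofReal
    _ ≤ ENNReal.ofReal (δ * ∫ x, ‖deriv u x‖ ^ 2) + ENNReal.ofReal δ⁻¹ *
          (ENNReal.ofReal M * ENNReal.ofReal (∫ s, (absSq u s + |deriv (absSq u) s|))) := by
        gcongr
        exact lintegral_weight_mul_test_le hΓm hM _ fun x => sq_nonneg _
    _ = _ := by
        rw [← ENNReal.ofReal_mul hM0, ← ENNReal.ofReal_mul (by positivity),
          ← ENNReal.ofReal_add (by positivity) (by positivity)]

theorem norm_integral_absSq_smul_le {γ : ℝ → ℂ} (hγ : LocallyIntegrable γ volume)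
    {M : ℝ} (hM0 : 0 ≤ M)
    (hM : ∀ x, ∫⁻ t in Set.Icc x (x + 1), ‖γ t‖ₑ ≤ ENNReal.ofReal M) (u : ComplexTest) :
    ‖∫ x, absSq u x • γ x‖ ≤ M * ∫ s, (absSq u s + |deriv (absSq u) s|) := by
  have hW : 0 ≤ ∫ s, (absSq u s + |deriv (absSq u) s|) :=
    integral_nonneg fun s => add_nonneg (sq_nonneg _) (abs_nonneg _)
  refine norm_integral_le_of_lintegral_le (by positivity) ?_
  rw [ENNReal.ofReal_mul hM0]
  refine le_trans (le_of_eq (lintegral_congr fun x => ?_)) (lintegral_weight_mul_test_le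
    hγ.aestronglyMeasurable.enorm hM (absSq u) fun x => sq_nonneg _)
  rw [enorm_smul, mul_comm, Real.enorm_of_nonneg (by simp)]

/-- `Γ' + γ` with uniformly locally bounded `Γ`, `γ` is infinitesimally form bounded. -/
theorem UniformBound.infinitesimallyFormBounded {Γ γ : ℝ → ℂ} (h : UniformBound Γ γ) :
    InfinitesimallyFormBounded (∂_{(1 : ℝ)} (ofFun Γ) + ofFun γ) := by
  obtain ⟨M, hM0, hM1, hM2⟩ := h.exists_bound
  intro ε hε
  -- Half of ε is spent on the Γ term, leaving K times the W^{1,1} norm of |u|² from both terms. The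
  -- other half is spent on that norm, via Kδ ≤ ε/2; the + 1 in δ covers K = 0.
  set K : ℝ := ((ε / 2)⁻¹ + 1) * M with hK
  have hK0 : 0 ≤ K := by positivity
  set δ : ℝ := ε / (2 * (K + 1)) with hδ
  have hδ0 : 0 < δ := by positivity
  have hKδ : K * δ ≤ ε / 2 := by
    rw [hδ, mul_div_assoc', div_le_div_iff₀ (by positivity) two_pos]
    nlinarith
  refine ⟨K * (1 + δ⁻¹) + 1, by positivity, fun u => ?_⟩
  rw [l2Norm_test_sq, l2Norm_deriv_sq]
  have hD : 0 ≤ ∫ x, ‖deriv u x‖ ^ 2 := integral_nonneg fun x => sq_nonneg _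
  have hN : 0 ≤ ∫ x, ‖u x‖ ^ 2 := integral_nonneg fun x => sq_nonneg _
  have h1 := norm_integral_deriv_absSq_smul_le h.1 hM0 hM1 u (half_pos hε)
  have h2 := norm_integral_absSq_smul_le h.2.1 hM0 hM2 u
  have h3 := mul_le_mul_of_nonneg_left (integral_absSq_add_abs_deriv_le u hδ0) hK0
  have h4 := mul_le_mul_of_nonneg_right hKδ hD
  unfold quadForm
  rw [deriv_ofFun_add_apply h.1 h.2.1]
  refine (norm_add_le _ _).trans ?_
  rw [norm_neg]
  generalize ∫ s, (absSq u s + |deriv (absSq u) s|) = W at *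
  generalize ∫ x, ‖deriv u x‖ ^ 2 = D at *
  generalize ∫ x, ‖u x‖ ^ 2 = N at *
  have h5 : (ε / 2)⁻¹ * (M * W) + M * W = K * W := by rw [hK]; ring
  linarith

/-! ### Polarization of the quadratic form -/

/-- The square of the Hilbert norm of `W^{1,2}(ℝ)` for real test functions. -/
def sobolevSq (φ : RealTest) : ℝ := ∫ x, (φ x ^ 2 + deriv φ x ^ 2)

theorem sobolevSq_nonneg (φ : RealTest) : 0 ≤ sobolevSq φ :=
  integral_nonneg fun _ => by positivity

theorem realTest_memLp (φ : RealTest) : MemLp φ 2 volume :=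
  φ.continuous.memLp_of_hasCompactSupport φ.hasCompactSupport

theorem realTest_deriv_memLp (φ : RealTest) : MemLp (deriv φ) 2 volume :=
  (test_continuous_deriv φ).memLp_of_hasCompactSupport φ.hasCompactSupport.deriv

theorem sobolevSq_integrable (φ : RealTest) : Integrable fun x => φ x ^ 2 + deriv φ x ^ 2 :=
  (realTest_memLp φ).integrable_sq.add (realTest_deriv_memLp φ).integrable_sq

theorem deriv_add_smul_test (φ ψ : RealTest) (t x : ℝ) :
    deriv (φ + t • ψ : RealTest) x = deriv φ x + t * deriv ψ x :=
  ((test_hasDerivAt φ x).add ((test_hasDerivAt ψ x).const_mul t)).deriv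

/-- The parallelogram law: the cross terms in t cancel. -/
theorem sobolevSq_add_add_sobolevSq_sub (φ ψ : RealTest) (t : ℝ) :
    sobolevSq (φ + t • ψ) + sobolevSq (φ + (-t) • ψ) =
      2 * sobolevSq φ + 2 * t ^ 2 * sobolevSq ψ := by
  unfold sobolevSq
  rw [← integral_const_mul, ← integral_const_mul, ← integral_add (sobolevSq_integrable _)
    (sobolevSq_integrable _), ← integral_add ((sobolevSq_integrable _).const_mul _)
    ((sobolevSq_integrable _).const_mul _)]
  refine integral_congr_ae (ae_of_all _ fun x => ?_)
  simp only [deriv_add_smul_test]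
  simp only [FunLike.coe_add, FunLike.coe_smul, Pi.add_apply, Pi.smul_apply, smul_eq_mul]
  ring

theorem FormBounded.exists_bound {Q : Distr} (h : FormBounded Q) :
    ∃ K : ℝ, 0 ≤ K ∧ ∀ φ : RealTest, ‖Q (mulTest φ φ)‖ ≤ K * sobolevSq φ := by
  obtain ⟨C, h⟩ := h
  -- The 2 comes from (a + b)² ≤ 2(a² + b²), as `w12Norm` is a sum of norms; C itself may be
  -- negative.
  refine ⟨2 * |C|, by positivity, fun φ => ?_⟩
  have h1 := h (toComplex φ)
  have h2 : absSq (toComplex φ) = mulTest φ φ := by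
    ext x
    simp [sq]
  have h3 : ∀ x, deriv (toComplex φ) x = ((deriv φ x : ℝ) : ℂ) := fun x =>
    (test_hasDerivAt φ x).ofReal_comp.deriv
  have h4 : l2Norm (toComplex φ) ^ 2 + l2Norm (deriv (toComplex φ)) ^ 2 = sobolevSq φ := by
    rw [l2Norm_test_sq, l2Norm_deriv_sq, sobolevSq, integral_add
      (realTest_memLp φ).integrable_sq (realTest_deriv_memLp φ).integrable_sq]
    simp [h3]
  unfold quadForm at h1
  rw [h2] at h1
  refine h1.trans ?_
  rw [← h4]
  unfold w12Norm
  have h5 := mul_le_mul_of_nonneg_right (le_abs_self C)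
    (sq_nonneg (l2Norm (toComplex φ) + l2Norm (deriv (toComplex φ))))
  nlinarith [mul_nonneg (abs_nonneg C)
    (sq_nonneg (l2Norm (toComplex φ) - l2Norm (deriv (toComplex φ))))]

/-- Cauchy–Schwarz inequality for a bounded quadratic form, by polarization. -/
theorem norm_mulTest_sq_le {Q : Distr} {K : ℝ}
    (h : ∀ φ : RealTest, ‖Q (mulTest φ φ)‖ ≤ K * sobolevSq φ) (θ ψ : RealTest) :
    ‖Q (mulTest θ ψ)‖ ^ 2 ≤ K ^ 2 * sobolevSq θ * sobolevSq ψ := by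
  have key : ∀ t : ℝ, 2 * |t| * ‖Q (mulTest θ ψ)‖ ≤
      K * sobolevSq θ + K * sobolevSq ψ * t ^ 2 := by
    intro t
    have h1 : mulTest (θ + t • ψ) (θ + t • ψ) - mulTest (θ + (-t) • ψ) (θ + (-t) • ψ) =
        (4 * t) • mulTest θ ψ := by
      ext x
      simp only [FunLike.coe_add, FunLike.coe_smul, FunLike.coe_sub, Pi.add_apply, Pi.sub_apply,
        Pi.smul_apply, smul_eq_mul, mulTest_apply]
      ring
    have h2 := norm_sub_le (Q (mulTest (θ + t • ψ) (θ + t • ψ)))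
      (Q (mulTest (θ + (-t) • ψ) (θ + (-t) • ψ)))
    rw [← map_sub, h1, map_smul, norm_smul, Real.norm_eq_abs, abs_mul] at h2
    have h3 := sobolevSq_add_add_sobolevSq_sub θ ψ t
    have h4 := h (θ + t • ψ)
    have h5 := h (θ + (-t) • ψ)
    have h6 : |(4 : ℝ)| = 4 := by norm_num
    rw [h6] at h2
    have h7 : K * sobolevSq (θ + t • ψ) + K * sobolevSq (θ + (-t) • ψ) =
      K * (2 * sobolevSq θ + 2 * t ^ 2 * sobolevSq ψ) := by rw [← mul_add, h3]
    linarith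
  -- The bound `key` for all t says that a real quadratic in t is nonnegative, so its discriminant
  -- is nonpositive; no case split on `sobolevSq ψ = 0` is needed.
  have hd := discrim_le_zero (a := K * sobolevSq ψ) (b := -2 * ‖Q (mulTest θ ψ)‖)
    (c := K * sobolevSq θ) fun t => by
      have h1 := key t
      have h2 := mul_le_mul_of_nonneg_right (le_abs_self t) (norm_nonneg (Q (mulTest θ ψ)))
      linarith [mul_self_nonneg t, sq t]
  unfold discrim at hd
  linarith

/-! ### Cutoff functions and their action on W^{1,2} -/

/-- A smooth function equal to `1` on `[-a, a]` which vanishes outside `[-a - 1, a + 1]`. -/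
def plateau (a : ℕ) : RealTest where
  toFun x := Real.smoothTransition (x + a + 1) - Real.smoothTransition (x - a)
  contDiff' := by
    have h : ContDiff ℝ ∞ Real.smoothTransition := Real.smoothTransition.contDiff
    exact (h.comp (by fun_prop)).sub (h.comp (by fun_prop))
  hasCompactSupport' := by
    refine HasCompactSupport.intro (isCompact_Icc (a := -(a : ℝ) - 1) (b := a + 1)) fun x hx => ?_
    rw [Set.mem_Icc, not_and_or, not_le, not_le] at hx
    have ha : (0 : ℝ) ≤ a := Nat.cast_nonneg a
    rcases hx with hx | hx
    · rw [Real.smoothTransition.zero_of_nonpos (by linarith),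
        Real.smoothTransition.zero_of_nonpos (by linarith), sub_zero]
    · rw [Real.smoothTransition.one_of_one_le (by linarith),
        Real.smoothTransition.one_of_one_le (by linarith), sub_self]
  tsupport_subset' := fun _ _ => trivial

theorem plateau_apply (a : ℕ) (x : ℝ) : plateau a x =
    Real.smoothTransition (x + a + 1) - Real.smoothTransition (x - a) := rfl

theorem plateau_eq_one {a : ℕ} {x : ℝ} (hx : |x| ≤ a) : plateau a x = 1 := by
  rw [abs_le] at hx
  rw [plateau_apply, Real.smoothTransition.one_of_one_le (by linarith),
    Real.smoothTransition.zero_of_nonpos (by linarith), sub_zero]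

theorem plateau_eq_zero {a : ℕ} {x : ℝ} (hx : (a : ℝ) + 1 ≤ |x|) : plateau a x = 0 := by
  have ha : (0 : ℝ) ≤ a := Nat.cast_nonneg a
  rw [plateau_apply]
  rcases le_abs.1 hx with hx | hx
  · rw [Real.smoothTransition.one_of_one_le (by linarith),
      Real.smoothTransition.one_of_one_le (by linarith), sub_self]
  · rw [Real.smoothTransition.zero_of_nonpos (by linarith),
      Real.smoothTransition.zero_of_nonpos (by linarith), sub_zero]

/-- The translate of a test function. -/
def translate (c : ℝ) (φ : RealTest) : RealTest where
  toFun x := φ (x - c)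
  contDiff' := φ.contDiff.comp (by fun_prop)
  hasCompactSupport' := φ.hasCompactSupport.comp_homeomorph (Homeomorph.subRight c)
  tsupport_subset' := fun _ _ => trivial

theorem translate_apply (c : ℝ) (φ : RealTest) (x : ℝ) : translate c φ x = φ (x - c) := rfl

theorem deriv_translate (c : ℝ) (φ : RealTest) (x : ℝ) :
    deriv (translate c φ) x = deriv φ (x - c) :=
  deriv_comp_sub_const φ c x

theorem sobolevSq_translate (c : ℝ) (φ : RealTest) :
    sobolevSq (translate c φ) = sobolevSq φ := by
  unfold sobolevSq
  simp only [deriv_translate, translate_apply]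
  exact integral_sub_right_eq_self (fun x => φ x ^ 2 + deriv φ x ^ 2) c

theorem exists_test_bound (φ : RealTest) : ∃ B : ℝ, ∀ x, |φ x| ≤ B ∧ |deriv φ x| ≤ B := by
  obtain ⟨B₁, h₁⟩ := φ.hasCompactSupport.exists_bound_of_continuous φ.continuous
  obtain ⟨B₂, h₂⟩ := φ.hasCompactSupport.deriv.exists_bound_of_continuous (test_continuous_deriv φ)
  exact ⟨max B₁ B₂, fun x => ⟨(h₁ x).trans (le_max_left _ _), (h₂ x).trans (le_max_right _ _)⟩⟩

/-- Multiplication by a test function is bounded in `W^{1,2}`, locally. -/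
theorem sobolevSq_mulTest_le {χ : RealTest} {B : ℝ} (hB : ∀ x, |χ x| ≤ B ∧ |deriv χ x| ≤ B)
    {s : Set ℝ} (hs : IsClosed s) (hχ : ∀ x, x ∉ s → χ x = 0) (φ : RealTest) :
    sobolevSq (mulTest χ φ) ≤ 3 * B ^ 2 * ∫ x in s, (φ x ^ 2 + deriv φ x ^ 2) := by
  unfold sobolevSq
  rw [← integral_indicator hs.measurableSet, ← integral_const_mul]
  refine integral_mono (sobolevSq_integrable _)
    (((sobolevSq_integrable φ).indicator hs.measurableSet).const_mul _) fun x => ?_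
  have hd : deriv (mulTest χ φ) x = deriv χ x * φ x + χ x * deriv φ x :=
    ((test_hasDerivAt χ x).mul (test_hasDerivAt φ x)).deriv
  simp only [hd, mulTest_apply]
  by_cases hx : x ∈ s
  · rw [Set.indicator_of_mem hx]
    -- In the constant 3B², two units come from (χ'φ + χφ')² ≤ 2(χ'φ)² + 2(χφ')² and one from (χφ)².
    have h1 := sq_le_sq' (abs_le.1 (hB x).1).1 (abs_le.1 (hB x).1).2
    have h2 := sq_le_sq' (abs_le.1 (hB x).2).1 (abs_le.1 (hB x).2).2
    have h3 := mul_le_mul_of_nonneg_right h1 (sq_nonneg (φ x))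
    have h4 := mul_le_mul_of_nonneg_right h2 (sq_nonneg (φ x))
    have h5 := mul_le_mul_of_nonneg_right h1 (sq_nonneg (deriv φ x))
    nlinarith [sq_nonneg (deriv χ x * φ x - χ x * deriv φ x),
      mul_nonneg (sq_nonneg B) (sq_nonneg (deriv φ x))]
  -- As s is closed, χ vanishes near x, so χ' vanishes at x too.
  · have h0 : χ =ᶠ[𝓝 x] fun _ => 0 := by
      filter_upwards [hs.isOpen_compl.mem_nhds hx] with y hy using hχ y hy
    rw [Set.indicator_of_notMem hx, hχ x hx, h0.deriv_eq]
    simp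

/-! ### Riesz representation of functionals bounded in W^{1,2} -/

/-- A linear functional bounded by the norm of a linear map to a Hilbert space is represented
by a vector of that space. -/
theorem exists_inner_eq_of_abs_le {V H : Type*} [AddCommGroup V] [Module ℝ V]
    [NormedAddCommGroup H] [InnerProductSpace ℝ H] [CompleteSpace H]
    (f : V →ₗ[ℝ] H) (T : V →ₗ[ℝ] ℝ) {M : ℝ} (hM : 0 ≤ M) (hT : ∀ v, |T v| ≤ M * ‖f v‖) :
    ∃ g : H, ‖g‖ ≤ M ∧ ∀ v, T v = inner ℝ g (f v) := by
  -- A merely algebraic section σ suffices: T kills the kernel of f by `hT`, so T ∘ σ is the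
  -- functional induced by T on the range. Hahn–Banach extends it to H, so the range need not be
  -- closed.
  obtain ⟨σ, hσ⟩ := f.rangeRestrict.exists_rightInverse_of_surjective f.range_rangeRestrict
  have hσ' : ∀ y : LinearMap.range f, f (σ y) = y := fun y =>
    congrArg Subtype.val (LinearMap.congr_fun hσ y)
  let L : StrongDual ℝ (LinearMap.range f) := (T ∘ₗ σ).mkContinuous M fun y => by
    have h := hT (σ y)
    rw [hσ'] at h
    exact h
  have hL : ‖L‖ ≤ M := LinearMap.mkContinuous_norm_le _ hM _
  obtain ⟨G, hG, hGn⟩ := exists_extension_norm_eq (𝕜 := ℝ) (LinearMap.range f) L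
  refine ⟨(InnerProductSpace.toDual ℝ H).symm G, ?_, fun v => ?_⟩
  · rw [LinearIsometryEquiv.norm_map, hGn]
    exact hL
  · rw [InnerProductSpace.toDual_symm_apply]
    have h1 : G (f v) = T (σ (f.rangeRestrict v)) := hG (f.rangeRestrict v)
    rw [h1, ← sub_eq_zero, ← map_sub, ← abs_nonpos_iff]
    refine (hT _).trans_eq ?_
    rw [map_sub, hσ']
    simp

/-- The function `φ + i φ'`. -/
def jet (φ : RealTest) (x : ℝ) : ℂ := ⟨φ x, deriv φ x⟩

theorem jet_eq (φ : RealTest) : jet φ = fun x => (φ x : ℂ) + (deriv φ x : ℝ) * Complex.I := by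
  ext x
  exact Complex.mk_eq_add_mul_I _ _

theorem norm_jet_sq (φ : RealTest) (x : ℝ) : ‖jet φ x‖ ^ 2 = φ x ^ 2 + deriv φ x ^ 2 := by
  rw [Complex.sq_norm, Complex.normSq_apply]
  simp [jet, sq]

theorem jet_memLp (φ : RealTest) (s : Set ℝ) : MemLp (jet φ) 2 (volume.restrict s) := by
  refine MemLp.restrict s ?_
  rw [memLp_two_iff_integrable_sq_norm]
  · simp only [norm_jet_sq]
    exact sobolevSq_integrable φ
  · rw [jet_eq]
    have h := test_continuous_deriv φ
    have h' := φ.continuous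
    exact Continuous.aestronglyMeasurable (by fun_prop)

/-- The linear map `φ ↦ φ + i φ'` into `L²(s)`. -/
def jetL2 (s : Set ℝ) : RealTest →ₗ[ℝ] Lp ℂ 2 (volume.restrict s) where
  toFun φ := (jet_memLp φ s).toLp
  map_add' φ ψ := by
    rw [← MemLp.toLp_add]
    refine MemLp.toLp_congr _ _ (ae_of_all _ fun x => ?_)
    have h : deriv (φ + ψ : RealTest) x = deriv φ x + deriv ψ x :=
      ((test_hasDerivAt φ x).add (test_hasDerivAt ψ x)).deriv
    apply Complex.ext
    · rfl
    · exact h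
  map_smul' c φ := by
    rw [RingHom.id_apply, ← MemLp.toLp_const_smul]
    refine MemLp.toLp_congr _ _ (ae_of_all _ fun x => ?_)
    have h : deriv (c • φ : RealTest) x = c * deriv φ x :=
      ((test_hasDerivAt φ x).const_mul c).deriv
    apply Complex.ext
    · simp [jet]
    · exact h.trans (by simp [jet])

theorem norm_jetL2_sq (s : Set ℝ) (φ : RealTest) :
    ‖jetL2 s φ‖ ^ 2 = ∫ x in s, (φ x ^ 2 + deriv φ x ^ 2) := by
  rw [← real_inner_self_eq_norm_sq, L2.inner_def]
  refine integral_congr_ae ?_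
  filter_upwards [(jet_memLp φ s).coeFn_toLp] with x hx
  change inner ℝ ((jet_memLp φ s).toLp (jet φ) x) ((jet_memLp φ s).toLp (jet φ) x) = _
  rw [hx, real_inner_self_eq_norm_sq, norm_jet_sq]

theorem lintegral_enorm_sq_Lp {μ : Measure ℝ} (g : Lp ℂ 2 μ) :
    ∫⁻ x, ‖g x‖ₑ ^ 2 ∂μ = ENNReal.ofReal (‖g‖ ^ 2) := by
  rw [← real_inner_self_eq_norm_sq, L2.inner_def, ofReal_integral_eq_lintegral_ofReal]
  · refine lintegral_congr fun x => ?_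
    rw [real_inner_self_eq_norm_sq, ENNReal.ofReal_pow (norm_nonneg _), ofReal_norm]
  · exact L2.integrable_inner g g
  · exact ae_of_all _ fun x => real_inner_self_nonneg

/-- A real functional bounded by the `W^{1,2}` norm on `s` is given by an `L²` function on `s`. -/
theorem exists_representation_real (T : RealTest →ₗ[ℝ] ℝ) {s : Set ℝ} {M : ℝ} (hM : 0 ≤ M)
    (hT : ∀ φ : RealTest, |T φ| ^ 2 ≤ M ^ 2 * ∫ x in s, (φ x ^ 2 + deriv φ x ^ 2)) :
    ∃ g : ℝ → ℂ, Measurable g ∧ ∫⁻ x in s, ‖g x‖ₑ ^ 2 ≤ ENNReal.ofReal (M ^ 2) ∧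
      ∀ φ : RealTest, Integrable (fun x => φ x * (g x).re + deriv φ x * (g x).im) (volume.restrict s) ∧
        T φ = ∫ x in s, (φ x * (g x).re + deriv φ x * (g x).im) := by
  -- With ℂ read as the real plane, L²(s; ℂ) is a real Hilbert space in which φ + iφ' has the
  -- W^{1,2}(s) norm of φ.
  obtain ⟨g, hg, hgT⟩ := exists_inner_eq_of_abs_le (jetL2 s) T hM fun φ => by
    refine abs_le_of_sq_le_sq' ?_ (by positivity) |>.2
    rw [mul_pow, norm_jetL2_sq]
    exact hT φ
  have hae : ∀ φ : RealTest, (fun x => inner ℝ (g x) (jetL2 s φ x)) =ᵐ[volume.restrict s]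
      fun x => φ x * (g x).re + deriv φ x * (g x).im := fun φ => by
    filter_upwards [(jet_memLp φ s).coeFn_toLp] with x hx
    change inner ℝ (g x) ((jet_memLp φ s).toLp (jet φ) x) = _
    rw [hx, Complex.inner]
    simp [jet]
  refine ⟨g, (Lp.stronglyMeasurable g).measurable, ?_, fun φ => ⟨?_, ?_⟩⟩
  · rw [lintegral_enorm_sq_Lp]
    exact ENNReal.ofReal_le_ofReal (pow_le_pow_left₀ (norm_nonneg _) hg 2)
  · exact (L2.integrable_inner g (jetL2 s φ)).congr (hae φ)
  · rw [hgT, L2.inner_def]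
    exact integral_congr_ae (hae φ)

/-- A complex functional bounded by the `W^{1,2}` norm on `s` is of the form
`φ ↦ ∫ (φ a + φ' b)` with square integrable functions `a`, `b` supported in `s`. -/
theorem exists_representation (T : RealTest →ₗ[ℝ] ℂ) {s : Set ℝ} (hs : MeasurableSet s)
    {M : ℝ} (hM : 0 ≤ M)
    (hT : ∀ φ : RealTest, ‖T φ‖ ^ 2 ≤ M ^ 2 * ∫ x in s, (φ x ^ 2 + deriv φ x ^ 2)) :
    ∃ a b : ℝ → ℂ, Measurable a ∧ Measurable b ∧
      (∫⁻ x, ‖a x‖ₑ ^ 2 ≤ ENNReal.ofReal (2 * M ^ 2)) ∧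
      (∫⁻ x, ‖b x‖ₑ ^ 2 ≤ ENNReal.ofReal (2 * M ^ 2)) ∧
      (∀ x, x ∉ s → a x = 0) ∧ (∀ x, x ∉ s → b x = 0) ∧
      ∀ φ : RealTest, Integrable (fun x => φ x • a x + deriv φ x • b x) ∧
        T φ = ∫ x, (φ x • a x + deriv φ x • b x) := by
  obtain ⟨g, hg, hgM, hgT⟩ := exists_representation_real (Complex.reLm ∘ₗ T) hM fun φ =>
    (pow_le_pow_left₀ (abs_nonneg _) (Complex.abs_re_le_norm (T φ)) 2).trans (hT φ)
  obtain ⟨k, hk, hkM, hkT⟩ := exists_representation_real (Complex.imLm ∘ₗ T) hM fun φ =>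
    (pow_le_pow_left₀ (abs_nonneg _) (Complex.abs_im_le_norm (T φ)) 2).trans (hT φ)
  have hbound : ∀ p : ℝ → ℂ, (∀ x, ‖p x‖ ^ 2 ≤ ‖g x‖ ^ 2 + ‖k x‖ ^ 2) →
      ∫⁻ x, ‖s.indicator p x‖ₑ ^ 2 ≤ ENNReal.ofReal (2 * M ^ 2) := fun p hp => by
    have h1 : ∀ x, ‖s.indicator p x‖ₑ ^ 2 = s.indicator (fun x => ‖p x‖ₑ ^ 2) x := fun x => by
      by_cases hx : x ∈ s <;> simp [hx]
    simp only [h1]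
    rw [lintegral_indicator hs, two_mul, ENNReal.ofReal_add (by positivity) (by positivity)]
    refine le_trans (lintegral_mono fun x => ?_) ((lintegral_add_left
      (hg.enorm.pow_const 2) fun x => ‖k x‖ₑ ^ 2).trans_le (add_le_add hgM hkM))
    rw [← ofReal_norm, ← ofReal_norm, ← ofReal_norm, ← ENNReal.ofReal_pow (norm_nonneg _),
      ← ENNReal.ofReal_pow (norm_nonneg _), ← ENNReal.ofReal_pow (norm_nonneg _),
      ← ENNReal.ofReal_add (by positivity) (by positivity)]
    exact ENNReal.ofReal_le_ofReal (hp x)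
  -- Here g represents Re T and k represents Im T; real parts of g, k pair with φ and imaginary
  -- parts with φ'.
  set a : ℝ → ℂ := fun x => ((g x).re : ℂ) + ((k x).re : ℂ) * Complex.I with ha
  set b : ℝ → ℂ := fun x => ((g x).im : ℂ) + ((k x).im : ℂ) * Complex.I with hb
  have ham : Measurable a := by fun_prop
  have hbm : Measurable b := by fun_prop
  have hcomb : ∀ φ : RealTest, (fun x => φ x • s.indicator a x + deriv φ x • s.indicator b x) =
      s.indicator fun x => ((φ x * (g x).re + deriv φ x * (g x).im : ℝ) : ℂ) +
        ((φ x * (k x).re + deriv φ x * (k x).im : ℝ) : ℂ) * Complex.I := fun φ => by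
    ext1 x
    by_cases hx : x ∈ s
    · simp only [Set.indicator_of_mem hx, ha, hb, Complex.real_smul]
      push_cast
      ring
    · simp [Set.indicator_of_notMem hx]
  refine ⟨s.indicator a, s.indicator b, ham.indicator hs, hbm.indicator hs, hbound a fun x => ?_,
    hbound b fun x => ?_, fun x hx => Set.indicator_of_notMem hx _,
    fun x hx => Set.indicator_of_notMem hx _, fun φ => ⟨?_, ?_⟩⟩
  · rw [Complex.sq_norm, Complex.sq_norm, Complex.sq_norm, ha, Complex.normSq_add_mul_I,
      Complex.normSq_apply, Complex.normSq_apply]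
    nlinarith [sq_nonneg (g x).im, sq_nonneg (k x).im]
  · rw [Complex.sq_norm, Complex.sq_norm, Complex.sq_norm, hb, Complex.normSq_add_mul_I,
      Complex.normSq_apply, Complex.normSq_apply]
    nlinarith [sq_nonneg (g x).re, sq_nonneg (k x).re]
  · rw [hcomb, integrable_indicator_iff hs]
    exact (hgT φ).1.ofReal.add ((hkT φ).1.ofReal.mul_const _)
  · rw [hcomb, integral_indicator hs, integral_add (hgT φ).1.ofReal
      ((hkT φ).1.ofReal.mul_const _), integral_mul_const, integral_complex_ofReal, integral_complex_ofReal,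
      ← (hgT φ).2, ← (hkT φ).2]
    exact (Complex.re_add_im (T φ)).symm

/-! ### Gluing functions supported in overlapping intervals -/

theorem locallyIntegrable_of_lintegral_Icc {f : ℝ → ℂ} (hf : AEStronglyMeasurable f volume)
    {M : ENNReal} (hM : M < ⊤) (h : ∀ x, ∫⁻ t in Set.Icc x (x + 1), ‖f t‖ₑ ≤ M) :
    LocallyIntegrable f volume := fun x =>
  ⟨Set.Icc (x - 1 / 2) (x - 1 / 2 + 1), Icc_mem_nhds (by linarith) (by linarith),
    hf.restrict, (h _).trans_lt hM⟩

theorem enorm_le_one_add_sq (z : ℂ) : ‖z‖ₑ ≤ 1 + ‖z‖ₑ ^ 2 := by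
  rw [← ofReal_norm, ← ENNReal.ofReal_pow (norm_nonneg _), ← ENNReal.ofReal_one,
    ← ENNReal.ofReal_add zero_le_one (by positivity)]
  exact ENNReal.ofReal_le_ofReal (by nlinarith [sq_nonneg (‖z‖ - 1)])

theorem lintegral_Icc_enorm_le {f : ℝ → ℂ} {M : ENNReal}
    (h : ∀ x, ∫⁻ t in Set.Icc x (x + 1), ‖f t‖ₑ ^ 2 ≤ M) (x : ℝ) :
    ∫⁻ t in Set.Icc x (x + 1), ‖f t‖ₑ ≤ 1 + M := by
  refine (lintegral_mono fun t => enorm_le_one_add_sq (f t)).trans ?_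
  rw [lintegral_add_left measurable_const]
  refine add_le_add ?_ (h x)
  simp

theorem uniformBound_of_le {Γ γ : ℝ → ℂ} (hΓ : AEStronglyMeasurable Γ volume)
    (hγ : AEStronglyMeasurable γ volume) {M₁ M₂ : ENNReal} (hM₁ : M₁ < ⊤) (hM₂ : M₂ < ⊤)
    (h₁ : ∀ x, ∫⁻ t in Set.Icc x (x + 1), ‖Γ t‖ₑ ^ 2 ≤ M₁)
    (h₂ : ∀ x, ∫⁻ t in Set.Icc x (x + 1), ‖γ t‖ₑ ≤ M₂) : UniformBound Γ γ := by
  refine ⟨locallyIntegrable_of_lintegral_Icc hΓ (ENNReal.add_lt_top.2 ⟨ENNReal.one_lt_top, hM₁⟩)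
    (lintegral_Icc_enorm_le h₁), locallyIntegrable_of_lintegral_Icc hγ hM₂ h₂,
    lt_of_le_of_lt (iSup_le fun x => ?_) (ENNReal.add_lt_top.2 ⟨hM₁, hM₂⟩)⟩
  rw [lintegral_add_left' (hΓ.enorm.pow_const 2).restrict]
  exact add_le_add (h₁ x) (h₂ x)

/-- A sum over integers whose terms vanish except at `⌊x⌋` and `⌊x⌋ + 1`. -/
theorem sum_Icc_eq_floor_add {F : Type*} [AddCommMonoid F] {A : ℤ → F} {x : ℝ} {N : ℕ}
    (hx : |x| ≤ N) (hA : ∀ n : ℤ, x ∉ Set.Ico ((n : ℝ) - 1) (n + 1) → A n = 0) :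
    ∑ n ∈ Finset.Icc (-(N : ℤ)) (N + 1), A n = A ⌊x⌋ + A (⌊x⌋ + 1) := by
  rw [abs_le] at hx
  rw [← Finset.sum_pair (f := A) (by omega)]
  symm
  -- The range of summation ends at N + 1 because ⌊x⌋ = N is possible.
  have h1 : -(N : ℤ) ≤ ⌊x⌋ := Int.le_floor.2 (by push_cast; linarith [hx.1])
  have h2 : ⌊x⌋ ≤ (N : ℤ) := by
    have : (⌊x⌋ : ℝ) ≤ N := (Int.floor_le x).trans hx.2
    exact_mod_cast this
  refine Finset.sum_subset (fun n hn => ?_) fun n _ hn => hA n fun h => hn ?_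
  · simp only [Finset.mem_insert, Finset.mem_singleton] at hn
    rw [Finset.mem_Icc]
    omega
  · have h3 : n ≤ ⌊x⌋ + 1 := by
      have : n - 1 ≤ ⌊x⌋ := Int.le_floor.2 (by push_cast; exact h.1)
      omega
    have h4 : ⌊x⌋ < n + 1 := Int.floor_lt.2 (by push_cast; exact h.2)
    simp only [Finset.mem_insert, Finset.mem_singleton]
    omega

/-- The function which is the sum of a family of functions supported in `[n - 1, n + 1)`. -/
def glue (A : ℤ → ℝ → ℂ) (x : ℝ) : ℂ := A ⌊x⌋ x + A (⌊x⌋ + 1) x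

theorem measurable_glue {A : ℤ → ℝ → ℂ} (hA : ∀ n, Measurable (A n)) : Measurable (glue A) := by
  have h : Measurable fun p : ℝ × ℤ => A p.2 p.1 := measurable_from_prod_countable_left hA
  exact (h.comp (measurable_id.prodMk Int.measurable_floor)).add
    (h.comp (measurable_id.prodMk (Int.measurable_floor.add_const 1)))

theorem enorm_add_sq_le (z w : ℂ) : ‖z + w‖ₑ ^ 2 ≤ 2 * (‖z‖ₑ ^ 2 + ‖w‖ₑ ^ 2) := by
  rw [← ofReal_norm, ← ofReal_norm, ← ofReal_norm, ← ENNReal.ofReal_pow (norm_nonneg _),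
    ← ENNReal.ofReal_pow (norm_nonneg _), ← ENNReal.ofReal_pow (norm_nonneg _),
    ← ENNReal.ofReal_add (by positivity) (by positivity), ← ENNReal.ofReal_ofNat 2,
    ← ENNReal.ofReal_mul (by norm_num)]
  refine ENNReal.ofReal_le_ofReal ?_
  have h := pow_le_pow_left₀ (norm_nonneg _) (norm_add_le z w) 2
  nlinarith [sq_nonneg (‖z‖ - ‖w‖)]

theorem lintegral_glue_le {A : ℤ → ℝ → ℂ} (hA : ∀ n, Measurable (A n)) {M : ENNReal}
    (hM : ∀ n, ∫⁻ x, ‖A n x‖ₑ ^ 2 ≤ M) (x : ℝ) :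
    ∫⁻ t in Set.Icc x (x + 1), ‖glue A t‖ₑ ^ 2 ≤ 2 * (M + (M + M)) := by
  -- On [x, x + 1] the floor takes at most two values, so at most three of the functions A n occur.
  have hpt : ∀ t ∈ Set.Icc x (x + 1), ‖glue A t‖ₑ ^ 2 ≤
      2 * (‖A ⌊x⌋ t‖ₑ ^ 2 + (‖A (⌊x⌋ + 1) t‖ₑ ^ 2 + ‖A (⌊x⌋ + 1 + 1) t‖ₑ ^ 2)) := by
    intro t ht
    have h1 : ⌊x⌋ ≤ ⌊t⌋ := Int.floor_mono ht.1
    have h2 : ⌊t⌋ ≤ ⌊x⌋ + 1 := by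
      rw [← Int.floor_add_one]
      exact Int.floor_mono ht.2
    refine (enorm_add_sq_le _ _).trans ?_
    rcases (show ⌊t⌋ = ⌊x⌋ ∨ ⌊t⌋ = ⌊x⌋ + 1 by omega) with h | h <;> rw [h]
    · exact mul_le_mul' le_rfl (add_le_add le_rfl le_self_add)
    · exact mul_le_mul' le_rfl le_add_self
  refine (setLIntegral_mono' measurableSet_Icc hpt).trans ((setLIntegral_le_lintegral _ _).trans ?_)
  rw [lintegral_const_mul' _ _ (by simp), lintegral_add_left ((hA _).enorm.pow_const 2),
    lintegral_add_left ((hA _).enorm.pow_const 2)]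
  gcongr <;> exact hM _

/-! ### Partition of unity and the decomposition Q = Γ' + γ -/

theorem exists_nat_abs_le_of_ne_zero (φ : RealTest) :
    ∃ N : ℕ, ∀ x, (N : ℝ) < |x| → φ x = 0 ∧ deriv φ x = 0 := by
  obtain ⟨R, hR⟩ := φ.hasCompactSupport.isCompact.isBounded.exists_norm_le
  refine ⟨⌈R⌉₊, fun x hx => ?_⟩
  have h : x ∉ tsupport φ := fun h => by
    have := (hR x h).trans (Nat.le_ceil R)
    rw [Real.norm_eq_abs] at this
    linarith
  exact ⟨image_eq_zero_of_notMem_tsupport h,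
    image_eq_zero_of_notMem_tsupport fun h' => h (tsupport_deriv_subset (f := φ) h')⟩

/-- `plateau 0` is s(x + 1) - s(x) with s the smooth transition, so its integer translates
telescope. -/
theorem plateau_translate_sum {x : ℝ} {N : ℕ} (hx : |x| ≤ N) :
    ∑ n ∈ Finset.Icc (-(N : ℤ)) (N + 1), translate n (plateau 0) x = 1 := by
  rw [sum_Icc_eq_floor_add hx]
  · have h1 := Int.floor_le x
    have h2 := Int.lt_floor_add_one x
    simp only [translate_apply, plateau_apply]
    push_cast
    rw [Real.smoothTransition.one_of_one_le (x := x - ⌊x⌋ + 0 + 1) (by linarith),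
      Real.smoothTransition.zero_of_nonpos (x := x - (⌊x⌋ + 1) - 0) (by linarith)]
    have h3 : x - (⌊x⌋ + 1) + 0 + 1 = x - ⌊x⌋ - 0 := by ring
    rw [h3]
    ring
  · intro n hn
    rw [translate_apply]
    apply plateau_eq_zero
    rw [Set.mem_Ico, not_and_or, not_le, not_lt] at hn
    rw [le_abs]
    push_cast
    rcases hn with hn | hn
    · right; linarith
    · left; linarith

theorem sum_mulTest_plateau (φ : RealTest) {N : ℕ}
    (hN : ∀ x, (N : ℝ) < |x| → φ x = 0 ∧ deriv φ x = 0) :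
    ∑ n ∈ Finset.Icc (-(N : ℤ)) (N + 1), mulTest (translate n (plateau 0)) φ = φ := by
  ext x
  have h : (∑ n ∈ Finset.Icc (-(N : ℤ)) (N + 1), mulTest (translate n (plateau 0)) φ) x =
      ∑ n ∈ Finset.Icc (-(N : ℤ)) (N + 1), mulTest (translate n (plateau 0)) φ x := by
    rw [FunLike.coe_sum, Finset.sum_apply]
  rw [h]
  simp only [mulTest_apply]
  rw [← Finset.sum_mul]
  by_cases hx : |x| ≤ N
  · rw [plateau_translate_sum hx, one_mul]
  · rw [(hN x (not_le.1 hx)).1, mul_zero]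

/-- The functional `φ ↦ Q(χ φ)`. -/
def localize (Q : Distr) (χ : RealTest) : RealTest →ₗ[ℝ] ℂ where
  toFun φ := Q (mulTest χ φ)
  map_add' φ ψ := by
    rw [← map_add]
    congr 1
    ext x
    exact mul_add _ _ _
  map_smul' c φ := by
    rw [RingHom.id_apply, ← map_smul]
    congr 1
    ext x
    exact mul_left_comm _ _ _

/-- Since `plateau 1` is 1 wherever `plateau 0` is nonzero, Q(χφ) = Q(θχφ) and the polarized
inequality applies to the pair θ, χφ. Translation invariance of the Sobolev norm makes the constant
independent of n. -/
theorem FormBounded.exists_local_bound {Q : Distr} (h : FormBounded Q) :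
    ∃ M : ℝ, 0 ≤ M ∧ ∀ (n : ℤ) (φ : RealTest),
      ‖localize Q (translate n (plateau 0)) φ‖ ^ 2 ≤
        M ^ 2 * ∫ x in Set.Ico ((n : ℝ) - 1) (n + 1), (φ x ^ 2 + deriv φ x ^ 2) := by
  obtain ⟨K, hK, hQ⟩ := h.exists_bound
  obtain ⟨B, hB⟩ := exists_test_bound (plateau 0)
  have hS := sobolevSq_nonneg (plateau 1)
  refine ⟨√(K ^ 2 * sobolevSq (plateau 1) * (3 * B ^ 2)), Real.sqrt_nonneg _, fun n φ => ?_⟩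
  rw [Real.sq_sqrt (by positivity), ← integral_Icc_eq_integral_Ico]
  have h1 : mulTest (translate n (plateau 1)) (mulTest (translate n (plateau 0)) φ) =
      mulTest (translate n (plateau 0)) φ := by
    ext x
    simp only [mulTest_apply, translate_apply]
    by_cases hx : |x - n| ≤ (1 : ℕ)
    · rw [plateau_eq_one hx, one_mul]
    · have : plateau 0 (x - n) = 0 := plateau_eq_zero (by
        push_cast at hx ⊢
        linarith)
      rw [this]
      ring
  have h2 := norm_mulTest_sq_le hQ (translate n (plateau 1)) (mulTest (translate n (plateau 0)) φ)
  rw [h1, sobolevSq_translate] at h2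
  have h3 : sobolevSq (mulTest (translate n (plateau 0)) φ) ≤
      3 * B ^ 2 * ∫ x in Set.Icc ((n : ℝ) - 1) (n + 1), (φ x ^ 2 + deriv φ x ^ 2) := by
    refine sobolevSq_mulTest_le (fun x => ?_) isClosed_Icc (fun x hx => ?_) φ
    · rw [deriv_translate]
      exact hB _
    · rw [translate_apply]
      apply plateau_eq_zero
      rw [Set.mem_Icc, not_and_or, not_le, not_le] at hx
      rw [le_abs]
      push_cast
      rcases hx with hx | hx
      · right; linarith
      · left; linarith
  refine h2.trans ((mul_le_mul_of_nonneg_left h3 (by positivity)).trans_eq (by ring))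

/-- A form bounded distribution is of the form `Γ' + γ` with uniformly locally bounded
`Γ`, `γ`. -/
theorem FormBounded.exists_representation {Q : Distr} (h : FormBounded Q) :
    ∃ Γ γ : ℝ → ℂ, UniformBound Γ γ ∧ Q = ∂_{(1 : ℝ)} (ofFun Γ) + ofFun γ := by
  obtain ⟨M, hM, hQ⟩ := h.exists_local_bound
  choose a b ha hb haM hbM ha0 hb0 hT using fun n : ℤ =>
    FormBoundedness.exists_representation (localize Q (translate n (plateau 0)))
      (measurableSet_Ico (a := (n : ℝ) - 1) (b := n + 1)) hM (hQ n)
  have hfin : 2 * (ENNReal.ofReal (2 * M ^ 2) + (ENNReal.ofReal (2 * M ^ 2) +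
      ENNReal.ofReal (2 * M ^ 2))) < ⊤ := by finiteness
  -- The sign compensates for the one in ⟨Γ', φ⟩ = -⟨Γ, φ'⟩.
  have hU : UniformBound (fun x => -glue b x) (glue a) := by
    refine uniformBound_of_le (measurable_glue hb).neg.aestronglyMeasurable
      (measurable_glue ha).aestronglyMeasurable hfin
      (ENNReal.add_lt_top.2 ⟨ENNReal.one_lt_top, hfin⟩) ?_
      (lintegral_Icc_enorm_le (lintegral_glue_le ha haM))
    simp only [enorm_neg]
    exact lintegral_glue_le hb hbM
  refine ⟨_, _, hU, ?_⟩
  ext φ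
  rw [deriv_ofFun_add_apply hU.1 hU.2.1]
  obtain ⟨N, hN⟩ := exists_nat_abs_le_of_ne_zero φ
  have hb' : Integrable fun x => deriv φ x • (-glue b x) :=
    hU.1.integrable_smul_left_of_hasCompactSupport (test_continuous_deriv φ)
      φ.hasCompactSupport.deriv
  have hb'' : Integrable fun x => -(deriv φ x • (-glue b x)) := hb'.neg
  rw [← integral_neg, ← integral_add hb'' (test_smul_integrable hU.2.1 φ)]
  conv_lhs => rw [← sum_mulTest_plateau φ hN, map_sum]
  change ∑ n ∈ Finset.Icc (-(N : ℤ)) (N + 1), localize Q (translate n (plateau 0)) φ = _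
  rw [Finset.sum_congr rfl fun n _ => (hT n φ).2, ← integral_finsetSum _ fun n _ => (hT n φ).1]
  refine integral_congr_ae (ae_of_all _ fun x => ?_)
  by_cases hx : |x| ≤ N
  · simp only []
    rw [sum_Icc_eq_floor_add hx fun n hn => by rw [ha0 n x hn, hb0 n x hn]; simp]
    simp only [glue, smul_neg, neg_neg, smul_add]
    ring
  · simp [(hN x (not_le.1 hx)).1, (hN x (not_le.1 hx)).2]

/-! ### Differential identities for the exponential kernels -/

/-- The function `t ↦ ∫ k(x - t) φ(x) dx`. -/
def adjConv (k φ : ℝ → ℝ) (t : ℝ) : ℝ := ∫ x, k (x - t) * φ x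

theorem hasDerivAt_integral_Iic {f : ℝ → ℝ} (hf : Continuous f) (hi : Integrable f) (t : ℝ) :
    HasDerivAt (fun s => ∫ x in Set.Iic s, f x) (f t) t := by
  have h : (fun s => ∫ x in Set.Iic s, f x) =
      fun s => (∫ x in Set.Iic (0 : ℝ), f x) + ∫ x in (0 : ℝ)..s, f x := by
    ext s
    rw [← intervalIntegral.integral_Iic_sub_Iic hi.integrableOn hi.integrableOn]
    ring
  rw [h]
  exact (hf.integral_hasStrictDerivAt 0 t).hasDerivAt.const_add _

theorem hasDerivAt_integral_Ioi {f : ℝ → ℝ} (hf : Continuous f) (hi : Integrable f) (t : ℝ) :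
    HasDerivAt (fun s => ∫ x in Set.Ioi s, f x) (-f t) t := by
  have h : (fun s => ∫ x in Set.Ioi s, f x) =
      fun s => (∫ x, f x) - ∫ x in Set.Iic s, f x := by
    ext s
    rw [← intervalIntegral.integral_Iic_add_Ioi (b := s) hi.integrableOn hi.integrableOn]
    ring
  rw [h]
  exact (hasDerivAt_integral_Iic hf hi t).const_sub _

theorem measurable_expKernel : Measurable expKernel := by
  unfold expKernel
  fun_prop

theorem measurable_signKernel : Measurable signKernel := by
  have h : Measurable Real.sign := by
    unfold Real.sign
    exact Measurable.ite measurableSet_Iio measurable_const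
      (Measurable.ite measurableSet_Ioi measurable_const measurable_const)
  exact h.mul measurable_expKernel

theorem abs_signKernel_le (x : ℝ) : |signKernel x| ≤ expKernel x := by
  unfold signKernel expKernel
  rw [abs_mul, Real.abs_exp]
  refine mul_le_of_le_one_left (Real.exp_pos _).le ?_
  rcases Real.sign_apply_eq x with h | h | h <;> simp [h]

theorem abs_expKernel_le (x : ℝ) : |expKernel x| ≤ expKernel x :=
  (Real.abs_exp _).le

theorem continuous_exp_mul (c : ℝ) {φ : ℝ → ℝ} (hφ : Continuous φ) :
    Continuous fun x => Real.exp (c * x) * φ x := by fun_prop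

theorem integrable_exp_mul (c : ℝ) {φ : ℝ → ℝ} (hφ : Continuous φ) (hc : HasCompactSupport φ) :
    Integrable fun x => Real.exp (c * x) * φ x :=
  (continuous_exp_mul c hφ).integrable_of_hasCompactSupport hc.mul_left

theorem integrable_kernel_mul {k φ : ℝ → ℝ} (hk : Measurable k) (hk1 : ∀ x, |k x| ≤ expKernel x)
    (hφ : Continuous φ) (hc : HasCompactSupport φ) (t : ℝ) :
    Integrable fun x => k (x - t) * φ x := by
  refine (hφ.integrable_of_hasCompactSupport hc).bdd_mul
    (hk.comp (measurable_id.sub_const t)).aestronglyMeasurable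
    (ae_of_all _ fun x => (hk1 (x - t)).trans ?_) (c := 1)
  exact Real.exp_le_one_iff.2 (by simp)

/-- On each side of t the kernel factors as a function of t times a function of x, which leaves
integrals over half-lines that can be differentiated in t. -/
theorem adjConv_expKernel {φ : ℝ → ℝ} (hφ : Continuous φ) (hc : HasCompactSupport φ) (t : ℝ) :
    adjConv expKernel φ t = Real.exp t * (∫ x in Set.Ioi t, Real.exp (-1 * x) * φ x) +
      Real.exp (-t) * ∫ x in Set.Iic t, Real.exp (1 * x) * φ x := by
  have hi := integrable_kernel_mul measurable_expKernel abs_expKernel_le hφ hc t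
  unfold adjConv
  rw [← intervalIntegral.integral_Iic_add_Ioi (b := t) hi.integrableOn hi.integrableOn, add_comm,
    ← integral_const_mul, ← integral_const_mul]
  congr 1
  · refine setIntegral_congr_fun measurableSet_Ioi fun x hx => ?_
    simp only [expKernel]
    rw [abs_of_pos (sub_pos.2 hx), ← mul_assoc, ← Real.exp_add]
    congr 2
    ring
  · refine setIntegral_congr_fun measurableSet_Iic fun x hx => ?_
    simp only [expKernel]
    rw [abs_of_nonpos (sub_nonpos.2 hx), ← mul_assoc, ← Real.exp_add]
    congr 2
    ring

theorem adjConv_signKernel {φ : ℝ → ℝ} (hφ : Continuous φ) (hc : HasCompactSupport φ) (t : ℝ) :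
    adjConv signKernel φ t = Real.exp t * (∫ x in Set.Ioi t, Real.exp (-1 * x) * φ x) -
      Real.exp (-t) * ∫ x in Set.Iic t, Real.exp (1 * x) * φ x := by
  have hi := integrable_kernel_mul measurable_signKernel abs_signKernel_le hφ hc t
  unfold adjConv
  rw [← intervalIntegral.integral_Iic_add_Ioi (b := t) hi.integrableOn hi.integrableOn, add_comm,
    ← integral_const_mul, ← integral_const_mul, sub_eq_add_neg, ← integral_neg]
  congr 1
  · refine setIntegral_congr_fun measurableSet_Ioi fun x hx => ?_
    simp only [signKernel]
    rw [abs_of_pos (sub_pos.2 hx), Real.sign_of_pos (sub_pos.2 hx), one_mul, ← mul_assoc,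
      ← Real.exp_add]
    congr 2
    ring
  -- The endpoint is dropped because sign(0) = 0, not -1.
  · rw [integral_Iic_eq_integral_Iio, integral_Iic_eq_integral_Iio]
    refine setIntegral_congr_fun measurableSet_Iio fun x hx => ?_
    simp only [signKernel]
    rw [abs_of_neg (sub_neg.2 hx), Real.sign_of_neg (sub_neg.2 hx), ← mul_assoc,
      ← Real.exp_add, neg_one_mul, neg_mul]
    congr 3
    ring

theorem hasDerivAt_adjConv_expKernel {φ : ℝ → ℝ} (hφ : Continuous φ) (hc : HasCompactSupport φ)
    (t : ℝ) : HasDerivAt (adjConv expKernel φ) (adjConv signKernel φ t) t := by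
  rw [funext (adjConv_expKernel hφ hc), adjConv_signKernel hφ hc]
  have h1 := (Real.hasDerivAt_exp t).mul
    (hasDerivAt_integral_Ioi (continuous_exp_mul (-1) hφ) (integrable_exp_mul (-1) hφ hc) t)
  have h2 := (hasDerivAt_neg t).exp.mul
    (hasDerivAt_integral_Iic (continuous_exp_mul 1 hφ) (integrable_exp_mul 1 hφ hc) t)
  refine (h1.add h2).congr_deriv ?_
  rw [neg_one_mul, one_mul, Real.exp_neg]
  field_simp
  ring

/-- The boundary terms at t, which cancel for `expKernel`, add up to -2φ(t) here: this is the jump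
of the sign. -/
theorem hasDerivAt_adjConv_signKernel {φ : ℝ → ℝ} (hφ : Continuous φ) (hc : HasCompactSupport φ)
    (t : ℝ) :
    HasDerivAt (adjConv signKernel φ) (adjConv expKernel φ t - 2 * φ t) t := by
  rw [funext (adjConv_signKernel hφ hc), adjConv_expKernel hφ hc]
  have h1 := (Real.hasDerivAt_exp t).mul
    (hasDerivAt_integral_Ioi (continuous_exp_mul (-1) hφ) (integrable_exp_mul (-1) hφ hc) t)
  have h2 := (hasDerivAt_neg t).exp.mul
    (hasDerivAt_integral_Iic (continuous_exp_mul 1 hφ) (integrable_exp_mul 1 hφ hc) t)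
  refine (h1.sub h2).congr_deriv ?_
  rw [neg_one_mul, one_mul, Real.exp_neg]
  field_simp
  ring

/-- Integration by parts on both half-lines. This identity recovers φ from the two kernels, hence Q
from its two convolutions. -/
theorem adjConv_signKernel_deriv (φ : RealTest) (t : ℝ) :
    adjConv signKernel (deriv φ) t = adjConv expKernel φ t - 2 * φ t := by
  have hφ := φ.continuous
  have hc := φ.hasCompactSupport
  have hφ' := test_continuous_deriv φ
  have hc' := φ.hasCompactSupport.deriv
  rw [adjConv_signKernel hφ' hc', adjConv_expKernel hφ hc]
  have hd : ∀ c x : ℝ, HasDerivAt (fun x => Real.exp (c * x) * φ x)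
      (c * (Real.exp (c * x) * φ x) + Real.exp (c * x) * deriv φ x) x := fun c x => by
    refine ((((hasDerivAt_id x).const_mul c).exp).mul (test_hasDerivAt φ x)).congr_deriv ?_
    simp only [id, mul_one]
    ring
  have hC : ∀ c : ℝ, ContDiff ℝ 1 fun x => Real.exp (c * x) * φ x := fun c => by
    have : ContDiff ℝ 1 φ := φ.contDiff.of_le (by simp)
    fun_prop
  have h1 := HasCompactSupport.integral_Ioi_deriv_eq (hC (-1)) hc.mul_left t
  have h2 := HasCompactSupport.integral_Iic_deriv_eq (hC 1) hc.mul_left t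
  rw [funext fun x => (hd (-1) x).deriv, integral_add
    ((integrable_exp_mul (-1) hφ hc).const_mul _).integrableOn
    (integrable_exp_mul (-1) hφ' hc').integrableOn, integral_const_mul] at h1
  rw [funext fun x => (hd 1 x).deriv, integral_add
    ((integrable_exp_mul 1 hφ hc).const_mul _).integrableOn
    (integrable_exp_mul 1 hφ' hc').integrableOn, integral_const_mul] at h2
  rw [show (∫ x in Set.Ioi t, Real.exp (-1 * x) * deriv φ x) =
    (∫ x in Set.Ioi t, Real.exp (-1 * x) * φ x) - Real.exp (-1 * t) * φ t by linarith,
    show (∫ x in Set.Iic t, Real.exp (1 * x) * deriv φ x) =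
    Real.exp (1 * t) * φ t - ∫ x in Set.Iic t, Real.exp (1 * x) * φ x by linarith]
  rw [neg_one_mul, one_mul, Real.exp_neg]
  field_simp
  ring

/-! ### Convolution of the kernels with uniformly locally integrable functions -/

/-- The convolution of a real kernel with a complex function. -/
def kernelConv (k : ℝ → ℝ) (f : ℝ → ℂ) (x : ℝ) : ℂ := ∫ t, k (x - t) • f t

theorem integrable_expKernel : Integrable expKernel := by
  have h : IntegrableOn expKernel (Set.Iic 0 ∪ Set.Ioi 0) := by
    refine IntegrableOn.union ?_ ?_
    · refine (integrableOn_exp_Iic 0).congr_fun (fun x hx => ?_) measurableSet_Iic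
      simp [expKernel, abs_of_nonpos (Set.mem_Iic.1 hx)]
    · refine (integrableOn_exp_neg_Ioi 0).congr_fun (fun x hx => ?_) measurableSet_Ioi
      simp [expKernel, abs_of_pos (Set.mem_Ioi.1 hx)]
  rwa [Set.Iic_union_Ioi, integrableOn_univ] at h

/-- The exponential kernel is controlled by its averages over unit intervals. -/
theorem ofReal_expKernel_le_average (x t : ℝ) : ENNReal.ofReal (expKernel (x - t)) ≤
    ∫⁻ s in Set.Icc t (t + 1), ENNReal.ofReal (Real.exp 1 * expKernel (s - x)) := by
  have h : ∀ s ∈ Set.Icc t (t + 1), ENNReal.ofReal (expKernel (x - t)) ≤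
      ENNReal.ofReal (Real.exp 1 * expKernel (s - x)) := fun s hs => by
    refine ENNReal.ofReal_le_ofReal ?_
    unfold expKernel
    rw [← Real.exp_add]
    refine Real.exp_le_exp.2 ?_
    -- Moving t to s changes |t - x| by at most 1, which costs the factor e.
    have h1 := abs_sub_abs_le_abs_sub (s - x) (t - x)
    rw [abs_sub_comm t x, sub_sub_sub_cancel_right, abs_of_nonneg (sub_nonneg.2 hs.1)] at h1
    linarith [hs.2]
  have h1 := setLIntegral_mono' (μ := volume) measurableSet_Icc h
  rw [setLIntegral_const, Real.volume_Icc] at h1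
  simpa using h1

/-- The total mass of the majorant of the exponential kernel. -/
def expMass : ENNReal := ∫⁻ s, ENNReal.ofReal (Real.exp 1 * expKernel s)

theorem expMass_lt_top : expMass < ⊤ := by
  have h := (integrable_expKernel.const_mul (Real.exp 1)).lintegral_lt_top
  exact h

theorem lintegral_kernel_mul_le {k : ℝ → ℝ} (hk : ∀ x, |k x| ≤ expKernel x) {f : ℝ → ℂ}
    (hf : AEStronglyMeasurable f volume) {M : ENNReal}
    (hM : ∀ x, ∫⁻ t in Set.Icc x (x + 1), ‖f t‖ₑ ≤ M) (x : ℝ) :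
    ∫⁻ t, ‖k (x - t) • f t‖ₑ ≤ M * expMass := by
  calc ∫⁻ t, ‖k (x - t) • f t‖ₑ
      ≤ ∫⁻ t, ‖f t‖ₑ * ENNReal.ofReal (expKernel (x - t)) := by
        refine lintegral_mono fun t => ?_
        rw [enorm_smul, mul_comm, Real.enorm_eq_ofReal_abs]
        exact mul_le_mul' le_rfl (ENNReal.ofReal_le_ofReal (hk _))
    _ ≤ M * ∫⁻ s, ENNReal.ofReal (Real.exp 1 * expKernel (s - x)) :=
        lintegral_mul_le_of_le_average hf.enorm
          ((measurable_expKernel.comp (measurable_id.sub_const x)).const_mul _).ennreal_ofReal hM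
          (ofReal_expKernel_le_average x)
    _ = M * expMass := by
        rw [lintegral_sub_right_eq_self (fun s => ENNReal.ofReal (Real.exp 1 * expKernel s)) x]
        rfl

theorem enorm_kernelConv_le {k : ℝ → ℝ} (hk : ∀ x, |k x| ≤ expKernel x) {f : ℝ → ℂ}
    (hf : AEStronglyMeasurable f volume) {M : ENNReal}
    (hM : ∀ x, ∫⁻ t in Set.Icc x (x + 1), ‖f t‖ₑ ≤ M) (x : ℝ) :
    ‖kernelConv k f x‖ₑ ≤ M * expMass :=
  (enorm_integral_le_lintegral_enorm _).trans (lintegral_kernel_mul_le hk hf hM x)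

theorem aestronglyMeasurable_kernel_smul {k : ℝ → ℝ} (hk : Measurable k) {f : ℝ → ℂ}
    (hf : AEStronglyMeasurable f volume) :
    AEStronglyMeasurable (fun p : ℝ × ℝ => k (p.1 - p.2) • f p.2) (volume.prod volume) :=
  (hk.comp (measurable_fst.sub measurable_snd)).aestronglyMeasurable.smul hf.comp_snd

theorem aestronglyMeasurable_kernelConv {k : ℝ → ℝ} (hk : Measurable k) {f : ℝ → ℂ}
    (hf : AEStronglyMeasurable f volume) : AEStronglyMeasurable (kernelConv k f) volume :=
  (aestronglyMeasurable_kernel_smul hk hf).integral_prod_right'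

section Fubini

variable {k : ℝ → ℝ} {f : ℝ → ℂ} {M : ENNReal}

theorem integrable_test_smul_kernel_smul (hk : Measurable k) (hk1 : ∀ x, |k x| ≤ expKernel x)
    (hf : AEStronglyMeasurable f volume) (hM0 : M < ⊤)
    (hM : ∀ x, ∫⁻ t in Set.Icc x (x + 1), ‖f t‖ₑ ≤ M) (φ : RealTest) :
    Integrable (fun p : ℝ × ℝ => φ p.1 • k (p.1 - p.2) • f p.2) (volume.prod volume) := by
  have hm : AEStronglyMeasurable (fun p : ℝ × ℝ => φ p.1 • k (p.1 - p.2) • f p.2)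
      (volume.prod volume) :=
    (φ.continuous.comp continuous_fst).aestronglyMeasurable.smul
      (aestronglyMeasurable_kernel_smul hk hf)
  refine ⟨hm, ?_⟩
  rw [hasFiniteIntegral_iff_enorm, lintegral_prod _ hm.enorm]
  have hφ := (φ.continuous.integrable_of_hasCompactSupport (μ := volume) φ.hasCompactSupport).2
  calc ∫⁻ x, ∫⁻ t, ‖φ x • k (x - t) • f t‖ₑ
      ≤ ∫⁻ x, ‖φ x‖ₑ * (M * expMass) := by
        refine lintegral_mono fun x => ?_
        simp only [enorm_smul (φ x)]
        rw [lintegral_const_mul' _ _ enorm_ne_top]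
        exact mul_le_mul' le_rfl (lintegral_kernel_mul_le hk1 hf hM x)
    _ = (∫⁻ x, ‖φ x‖ₑ) * (M * expMass) := lintegral_mul_const _ φ.continuous.measurable.enorm
    _ < ⊤ := ENNReal.mul_lt_top hφ (ENNReal.mul_lt_top hM0 expMass_lt_top)

theorem integral_test_smul_kernel_eq (k : ℝ → ℝ) (f : ℝ → ℂ) (φ : RealTest) (t : ℝ) :
    ∫ x, φ x • k (x - t) • f t = adjConv k φ t • f t := by
  unfold adjConv
  rw [← integral_smul_const]
  refine integral_congr_ae (ae_of_all _ fun x => ?_)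
  simp only [smul_smul, mul_comm]

theorem integrable_adjConv_smul (hk : Measurable k) (hk1 : ∀ x, |k x| ≤ expKernel x)
    (hf : AEStronglyMeasurable f volume) (hM0 : M < ⊤)
    (hM : ∀ x, ∫⁻ t in Set.Icc x (x + 1), ‖f t‖ₑ ≤ M) (φ : RealTest) :
    Integrable fun t => adjConv k φ t • f t := by
  have h := (integrable_test_smul_kernel_smul hk hk1 hf hM0 hM φ).integral_prod_right
  simpa only [integral_test_smul_kernel_eq] using h

/-- Convolution with `k` is adjoint to `adjConv k`. -/
theorem integral_smul_kernelConv (hk : Measurable k) (hk1 : ∀ x, |k x| ≤ expKernel x)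
    (hf : AEStronglyMeasurable f volume) (hM0 : M < ⊤)
    (hM : ∀ x, ∫⁻ t in Set.Icc x (x + 1), ‖f t‖ₑ ≤ M) (φ : RealTest) :
    ∫ x, φ x • kernelConv k f x = ∫ t, adjConv k φ t • f t := by
  have h := integral_integral_swap (f := fun x t => φ x • k (x - t) • f t)
    (integrable_test_smul_kernel_smul hk hk1 hf hM0 hM φ)
  simp only [integral_test_smul_kernel_eq, integral_smul] at h
  exact h

end Fubini

/-! ### Distributional convolutions of Γ' + γ -/

theorem cutoffConv_apply {k : ℝ → ℝ} (hk : LocallyIntegrable k volume) (η φ : RealTest) (t : ℝ) :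
    cutoffConv hk η φ t = η t * adjConv k φ t := rfl

theorem IsApproxUnit.exists_bound {η : ℕ → RealTest} (hη : IsApproxUnit η) :
    ∃ C : ℝ, ∀ n x, |η n x| ≤ C ∧ |deriv (η n) x| ≤ C := by
  obtain ⟨C₀, h₀⟩ := hη.1 0
  obtain ⟨C₁, h₁⟩ := hη.1 1
  simp only [iteratedDeriv_zero] at h₀
  simp only [iteratedDeriv_one] at h₁
  exact ⟨max C₀ C₁, fun n x =>
    ⟨(h₀ n x).trans (le_max_left _ _), (h₁ n x).trans (le_max_right _ _)⟩⟩

theorem IsApproxUnit.eventually_eq {η : ℕ → RealTest} (hη : IsApproxUnit η) (x : ℝ) :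
    ∀ᶠ n in atTop, η n x = 1 ∧ deriv (η n) x = 0 := by
  -- A whole neighbourhood of x is used so that the derivative vanishes as well.
  filter_upwards [hη.2 (Set.Icc (x - 1) (x + 1)) isCompact_Icc] with n hn
  refine ⟨hn x ⟨by linarith, by linarith⟩, ?_⟩
  have h : η n =ᶠ[𝓝 x] fun _ => 1 := by
    filter_upwards [Icc_mem_nhds (show x - 1 < x by linarith) (show x < x + 1 by linarith)]
      with y hy using hn y hy
  rw [h.deriv_eq, deriv_const]

/-- The pairing of `Γ' + γ` with a smooth function `ψ` along an approximate unit. -/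
theorem tendsto_cutoffConv {Γ γ : ℝ → ℂ} (hΓ : LocallyIntegrable Γ volume)
    (hγ : LocallyIntegrable γ volume) {k : ℝ → ℝ} (hk : LocallyIntegrable k volume)
    (φ : RealTest) {ψ' : ℝ → ℝ} (hψ : ∀ t, HasDerivAt (adjConv k φ) (ψ' t) t)
    (h₁ : Integrable fun t => adjConv k φ t • Γ t) (h₂ : Integrable fun t => ψ' t • Γ t)
    (h₃ : Integrable fun t => adjConv k φ t • γ t) {η : ℕ → RealTest} (hη : IsApproxUnit η) :
    Tendsto (fun n => (∂_{(1 : ℝ)} (ofFun Γ) + ofFun γ : Distr) (cutoffConv hk (η n) φ)) atTop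
      (𝓝 (-(∫ t, ψ' t • Γ t) + ∫ t, adjConv k φ t • γ t)) := by
  obtain ⟨C, hC⟩ := hη.exists_bound
  have hd : ∀ n t, deriv (cutoffConv hk (η n) φ) t =
      deriv (η n) t * adjConv k φ t + η n t * ψ' t := fun n t =>
    ((test_hasDerivAt (η n) t).mul (hψ t)).deriv
  simp only [deriv_ofFun_add_apply hΓ hγ]
  refine Tendsto.add (Tendsto.neg ?_) ?_
  · refine tendsto_integral_of_dominated_convergence
      (fun t => C * ‖adjConv k φ t • Γ t‖ + C * ‖ψ' t • Γ t‖) (fun n => ?_)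
      ((h₁.norm.const_mul C).add (h₂.norm.const_mul C)) (fun n => ae_of_all _ fun t => ?_)
      (ae_of_all _ fun t => ?_)
    · exact (test_continuous_deriv (cutoffConv hk (η n) φ)).aestronglyMeasurable.smul hΓ.aestronglyMeasurable
    · rw [hd, add_smul, mul_smul, mul_smul]
      refine (norm_add_le _ _).trans ?_
      rw [norm_smul (deriv (η n) t), norm_smul (η n t)]
      exact add_le_add (mul_le_mul_of_nonneg_right (hC n t).2 (norm_nonneg _))
        (mul_le_mul_of_nonneg_right (hC n t).1 (norm_nonneg _))
    · refine tendsto_const_nhds.congr' ?_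
      filter_upwards [hη.eventually_eq t] with n hn
      rw [hd, hn.1, hn.2, zero_mul, one_mul, zero_add]
  · refine tendsto_integral_of_dominated_convergence
      (fun t => C * ‖adjConv k φ t • γ t‖) (fun n => ?_)
      (h₃.norm.const_mul C) (fun n => ae_of_all _ fun t => ?_)
      (ae_of_all _ fun t => ?_)
    · exact (cutoffConv hk (η n) φ).continuous.aestronglyMeasurable.smul hγ.aestronglyMeasurable
    · rw [cutoffConv_apply, mul_smul, norm_smul (η n t)]
      exact mul_le_mul_of_nonneg_right (hC n t).1 (norm_nonneg _)
    · refine tendsto_const_nhds.congr' ?_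
      filter_upwards [hη.eventually_eq t] with n hn
      rw [cutoffConv_apply, hn.1, one_mul]

theorem lintegral_Icc_le_of_enorm_le {f : ℝ → ℂ} {B : ENNReal} (h : ∀ x, ‖f x‖ₑ ≤ B) (x : ℝ) :
    ∫⁻ t in Set.Icc x (x + 1), ‖f t‖ₑ ≤ B := by
  refine (lintegral_mono fun t => h t).trans ?_
  rw [setLIntegral_const, Real.volume_Icc]
  simp

/-- The convolutions of `Γ' + γ` with the two exponential kernels are uniformly locally bounded
functions. -/
theorem UniformBound.exists_isConvolution {Γ γ : ℝ → ℂ} (h : UniformBound Γ γ) :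
    ∃ G g : ℝ → ℂ, UniformBound G g ∧
      IsConvolution (∂_{(1 : ℝ)} (ofFun Γ) + ofFun γ) locallyIntegrable_signKernel (ofFun G) ∧
      IsConvolution (∂_{(1 : ℝ)} (ofFun Γ) + ofFun γ) locallyIntegrable_expKernel (ofFun g) := by
  obtain ⟨M, -, hM₁, hγM⟩ := h.exists_bound
  have hΓM := lintegral_Icc_enorm_le hM₁
  have hΓm := h.1.aestronglyMeasurable
  have hγm := h.2.1.aestronglyMeasurable
  have hf₁ : 1 + ENNReal.ofReal M < ⊤ := by finiteness
  have hf₂ : ENNReal.ofReal M < ⊤ := ENNReal.ofReal_lt_top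
  have hme := expMass_lt_top
  -- R is the bounded part of S∗Q = 2Γ + R, and g is E∗Q.
  set R : ℝ → ℂ := fun x => -kernelConv expKernel Γ x + kernelConv signKernel γ x with hR
  set g : ℝ → ℂ := fun x => -kernelConv signKernel Γ x + kernelConv expKernel γ x with hg
  have hke := fun {f : ℝ → ℂ} (hf : AEStronglyMeasurable f volume) =>
    aestronglyMeasurable_kernelConv measurable_expKernel hf
  have hks := fun {f : ℝ → ℂ} (hf : AEStronglyMeasurable f volume) =>
    aestronglyMeasurable_kernelConv measurable_signKernel hf
  set B : ENNReal := (1 + ENNReal.ofReal M) * expMass + ENNReal.ofReal M * expMass with hB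
  have hBf : B < ⊤ := ENNReal.add_lt_top.2 ⟨ENNReal.mul_lt_top hf₁ hme, ENNReal.mul_lt_top hf₂ hme⟩
  have hRB : ∀ x, ‖R x‖ₑ ≤ B := fun x => by
    refine (enorm_add_le _ _).trans ?_
    rw [enorm_neg]
    exact add_le_add (enorm_kernelConv_le abs_expKernel_le hΓm hΓM x)
      (enorm_kernelConv_le abs_signKernel_le hγm hγM x)
  have hgB : ∀ x, ‖g x‖ₑ ≤ B := fun x => by
    refine (enorm_add_le _ _).trans ?_
    rw [enorm_neg]
    exact add_le_add (enorm_kernelConv_le abs_signKernel_le hΓm hΓM x)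
      (enorm_kernelConv_le abs_expKernel_le hγm hγM x)
  have hRm : AEStronglyMeasurable R volume := (hke hΓm).neg.add (hks hγm)
  have hgm : AEStronglyMeasurable g volume := (hks hΓm).neg.add (hke hγm)
  have hGm : AEStronglyMeasurable (fun x => (2 : ℝ) • Γ x + R x) volume :=
    (hΓm.const_smul (2 : ℝ)).add hRm
  have hU : UniformBound (fun x => (2 : ℝ) • Γ x + R x) g := by
    refine uniformBound_of_le (M₁ := 2 * (2 ^ 2 * ENNReal.ofReal M + B ^ 2)) hGm hgm ?_ hBf ?_
      (lintegral_Icc_le_of_enorm_le hgB)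
    · have := hBf.ne
      finiteness
    · intro x
      refine (lintegral_mono fun t => enorm_add_sq_le _ _).trans ?_
      have h2 : AEMeasurable (fun t => ‖(2 : ℝ) • Γ t‖ₑ ^ 2) volume :=
        (hΓm.const_smul (2 : ℝ)).enorm.pow_const 2
      rw [lintegral_const_mul' _ _ (by simp), lintegral_add_left' h2.restrict]
      refine mul_le_mul' le_rfl (add_le_add ?_ ?_)
      · simp only [enorm_smul, mul_pow]
        rw [lintegral_const_mul' _ _ (by finiteness)]
        refine mul_le_mul' (le_of_eq ?_) (hM₁ x)
        rw [Real.enorm_of_nonneg zero_le_two, ENNReal.ofReal_ofNat]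
      · refine (lintegral_mono fun t => pow_le_pow_left' (hRB t) 2).trans ?_
        rw [setLIntegral_const, Real.volume_Icc]
        simp
  have hgl := hU.2.1
  have hRl : LocallyIntegrable R volume :=
    locallyIntegrable_of_lintegral_Icc hRm hBf (lintegral_Icc_le_of_enorm_le hRB)
  have hl : ∀ {k : ℝ → ℝ} {f : ℝ → ℂ} {N : ENNReal}, Measurable k → (∀ x, |k x| ≤ expKernel x) →
      AEStronglyMeasurable f volume → N < ⊤ →
      (∀ x, ∫⁻ t in Set.Icc x (x + 1), ‖f t‖ₑ ≤ N) →
      LocallyIntegrable (kernelConv k f) volume := fun hk hk1 hf hN hM =>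
    locallyIntegrable_of_lintegral_Icc (aestronglyMeasurable_kernelConv hk hf)
      (ENNReal.mul_lt_top hN hme)
      (lintegral_Icc_le_of_enorm_le (enorm_kernelConv_le hk1 hf hM))
  have hEΓ := fun φ : RealTest =>
    integrable_adjConv_smul measurable_expKernel abs_expKernel_le hΓm hf₁ hΓM φ
  have hSΓ := fun φ : RealTest =>
    integrable_adjConv_smul measurable_signKernel abs_signKernel_le hΓm hf₁ hΓM φ
  have hEγ := fun φ : RealTest =>
    integrable_adjConv_smul measurable_expKernel abs_expKernel_le hγm hf₂ hγM φ
  have hSγ := fun φ : RealTest =>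
    integrable_adjConv_smul measurable_signKernel abs_signKernel_le hγm hf₂ hγM φ
  have hsplit : ∀ {a b : ℝ → ℂ}, LocallyIntegrable a volume → LocallyIntegrable b volume →
      ∀ φ : RealTest, ∫ x, φ x • (-a x + b x) = -(∫ x, φ x • a x) + ∫ x, φ x • b x := by
    intro a b ha hb φ
    have ha' : Integrable fun x => -(φ x • a x) := (test_smul_integrable ha φ).neg
    rw [← integral_neg, ← integral_add ha' (test_smul_integrable hb φ)]
    simp only [smul_add, smul_neg]
  refine ⟨_, g, hU, fun φ η hη => ?_, fun φ η hη => ?_⟩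
  · have hI : Integrable fun t => (2 * φ t) • Γ t := by
      refine ((test_smul_integrable h.1 φ).smul (2 : ℝ)).congr (ae_of_all _ fun t => ?_)
      simp only [Pi.smul_apply, smul_smul]
    have hI' : Integrable fun t => (adjConv expKernel φ t - 2 * φ t) • Γ t := by
      simp only [sub_smul]
      exact (hEΓ φ).sub hI
    convert! tendsto_cutoffConv h.1 h.2.1 locallyIntegrable_signKernel φ
      (hasDerivAt_adjConv_signKernel φ.continuous φ.hasCompactSupport) (hSΓ φ) hI' (hSγ φ) hη
      using 2
    rw [ofFun_apply hU.1]
    simp only [sub_smul, smul_add]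
    rw [integral_sub (hEΓ φ) hI, integral_add _ (test_smul_integrable hRl φ),
      hsplit (hl measurable_expKernel abs_expKernel_le hΓm hf₁ hΓM)
        (hl measurable_signKernel abs_signKernel_le hγm hf₂ hγM),
      integral_smul_kernelConv measurable_expKernel abs_expKernel_le hΓm hf₁ hΓM,
      integral_smul_kernelConv measurable_signKernel abs_signKernel_le hγm hf₂ hγM]
    · simp only [smul_smul, mul_comm _ (2 : ℝ)]
      ring
    · simpa only [smul_smul, mul_comm _ (2 : ℝ)] using hI
  · convert! tendsto_cutoffConv h.1 h.2.1 locallyIntegrable_expKernel φ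
      (hasDerivAt_adjConv_expKernel φ.continuous φ.hasCompactSupport) (hEΓ φ) (hSΓ φ) (hEγ φ) hη
      using 2
    rw [ofFun_apply hgl, hg,
      hsplit (hl measurable_signKernel abs_signKernel_le hΓm hf₁ hΓM)
        (hl measurable_expKernel abs_expKernel_le hγm hf₂ hγM),
      integral_smul_kernelConv measurable_signKernel abs_signKernel_le hΓm hf₁ hΓM,
      integral_smul_kernelConv measurable_expKernel abs_expKernel_le hγm hf₂ hγM]

/-! ### Recovering Q from its two convolutions -/

theorem exists_iteratedDeriv_bound (φ : RealTest) (m : ℕ) :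
    ∃ C : ℝ, ∀ x, |iteratedDeriv m φ x| ≤ C := by
  have hc : HasCompactSupport (iteratedDeriv m φ) := by
    induction m with
    | zero => simpa using φ.hasCompactSupport
    | succ m ih => rw [iteratedDeriv_succ]; exact ih.deriv
  exact hc.exists_bound_of_continuous
    (φ.contDiff.continuous_iteratedDeriv m (by exact_mod_cast le_top))

/-- The dilation `x ↦ φ(c x)` of a test function. -/
def dilate (c : ℝ) (hc : c ≠ 0) (φ : RealTest) : RealTest where
  toFun x := φ (c * x)
  contDiff' := φ.contDiff.comp (by fun_prop)
  hasCompactSupport' := φ.hasCompactSupport.comp_homeomorph (Homeomorph.mulLeft₀ c hc)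
  tsupport_subset' := fun _ _ => trivial

/-- Dilating a fixed plateau by 1/(n + 1) multiplies its m-th derivative by (n + 1)^{-m} ≤ 1.
Existence matters because `IsConvolution` quantifies over all approximate units. -/
theorem exists_isApproxUnit : ∃ η : ℕ → RealTest, IsApproxUnit η := by
  have hc : ∀ n : ℕ, ((n : ℝ) + 1)⁻¹ ≠ 0 := fun n => by positivity
  refine ⟨fun n => dilate ((n : ℝ) + 1)⁻¹ (hc n) (plateau 1), fun m => ?_, fun K hK => ?_⟩
  · obtain ⟨C, hC⟩ := exists_iteratedDeriv_bound (plateau 1) m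
    refine ⟨C, fun n x => ?_⟩
    have h := congrFun (iteratedDeriv_comp_const_mul (n := m)
      ((plateau 1).contDiff.of_le (by exact_mod_cast le_top)) ((n : ℝ) + 1)⁻¹) x
    change |iteratedDeriv m (fun x => plateau 1 (((n : ℝ) + 1)⁻¹ * x)) x| ≤ C
    rw [h, abs_mul, abs_pow, abs_of_nonneg (by positivity)]
    refine (mul_le_of_le_one_left (abs_nonneg _) (pow_le_one₀ (by positivity) ?_)).trans (hC _)
    exact inv_le_one_of_one_le₀ (by linarith [Nat.cast_nonneg (α := ℝ) n])
  · obtain ⟨R, hR⟩ := hK.isBounded.exists_norm_le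
    filter_upwards [eventually_ge_atTop ⌈R⌉₊] with n hn x hx
    apply plateau_eq_one
    rw [abs_mul, abs_of_pos (by positivity), inv_mul_le_iff₀ (by positivity)]
    have h1 := hR x hx
    have h2 : R ≤ n := (Nat.le_ceil R).trans (by exact_mod_cast hn)
    rw [Real.norm_eq_abs] at h1
    push_cast
    linarith

theorem UniformBound.half {G g : ℝ → ℂ} (h : UniformBound G g) :
    UniformBound (fun x => (2⁻¹ : ℝ) • G x) (fun x => (2⁻¹ : ℝ) • g x) := by
  refine ⟨h.1.smul (2⁻¹ : ℝ), h.2.1.smul (2⁻¹ : ℝ), lt_of_le_of_lt (iSup_mono fun x =>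
    lintegral_mono fun t => ?_) h.2.2⟩
  have h2 : ‖(2⁻¹ : ℝ)‖ₑ ≤ 1 := by
    rw [Real.enorm_of_nonneg (by norm_num), ENNReal.ofReal_le_one]
    norm_num
  have h3 : ∀ z : ℂ, ‖(2⁻¹ : ℝ) • z‖ₑ ≤ ‖z‖ₑ := fun z => by
    rw [enorm_smul]
    exact (mul_le_mul' h2 le_rfl).trans_eq (one_mul _)
  exact add_le_add (pow_le_pow_left' (h3 _) 2) (h3 _)

/-- A distribution is recovered from its convolutions with the two exponential kernels. -/
theorem eq_of_isConvolution {Q : Distr} {G g : ℝ → ℂ} (h : UniformBound G g)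
    (hG : IsConvolution Q locallyIntegrable_signKernel (ofFun G))
    (hg : IsConvolution Q locallyIntegrable_expKernel (ofFun g)) :
    Q = ∂_{(1 : ℝ)} (ofFun fun x => (2⁻¹ : ℝ) • G x) + ofFun fun x => (2⁻¹ : ℝ) • g x := by
  obtain ⟨η, hη⟩ := exists_isApproxUnit
  ext φ
  rw [deriv_ofFun_add_apply h.half.1 h.half.2.1]
  have hlim := (hg φ η hη).sub (hG (∂_{(1 : ℝ)} φ) η hη)
  rw [ofFun_apply h.1, ofFun_apply h.2.1, coe_lineDeriv_test] at hlim
  -- Each convolved function may have noncompact support, but their difference is 2φ, so the cutoff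
  -- has no effect once η n = 1 on the support of φ.
  have hev : ∀ᶠ n in atTop, Q (cutoffConv locallyIntegrable_expKernel (η n) φ) -
      Q (cutoffConv locallyIntegrable_signKernel (η n) (∂_{(1 : ℝ)} φ)) = (2 : ℝ) • Q φ := by
    filter_upwards [hη.2 _ φ.hasCompactSupport] with n hn
    rw [← map_sub, ← map_smul]
    congr 1
    ext t
    change cutoffConv locallyIntegrable_expKernel (η n) φ t -
      cutoffConv locallyIntegrable_signKernel (η n) (∂_{(1 : ℝ)} φ) t = 2 * φ t
    rw [cutoffConv_apply, cutoffConv_apply, coe_lineDeriv_test, adjConv_signKernel_deriv]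
    by_cases ht : t ∈ tsupport φ
    · rw [hn t ht]
      ring
    · rw [image_eq_zero_of_notMem_tsupport ht]
      ring
  have h2 := tendsto_nhds_unique (tendsto_const_nhds.congr' (hev.mono fun n hn => hn.symm)) hlim
  simp only [smul_comm _ (2⁻¹ : ℝ), integral_smul]
  rw [← inv_smul_smul₀ (two_ne_zero (α := ℝ)) (Q φ), h2, smul_sub, sub_eq_neg_add]

end FormBoundedness

end

theorem mainTheorem5 (Q : FormBoundedness.Distr) :
    List.TFAE [
      FormBoundedness.InfinitesimallyFormBounded Q,
      FormBoundedness.FormBounded Q,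
      ∃ Γ γ : ℝ → ℂ, FormBoundedness.UniformBound Γ γ ∧
        Q = ∂_{(1 : ℝ)} (FormBoundedness.ofFun Γ) + FormBoundedness.ofFun γ,
      ∃ Γ γ : ℝ → ℂ, FormBoundedness.UniformBound Γ γ ∧
        FormBoundedness.IsConvolution Q FormBoundedness.locallyIntegrable_signKernel
          (FormBoundedness.ofFun Γ) ∧
        FormBoundedness.IsConvolution Q FormBoundedness.locallyIntegrable_expKernel
          (FormBoundedness.ofFun γ)] := by
  tfae_have 1 → 2 := FormBoundedness.InfinitesimallyFormBounded.formBounded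
  tfae_have 2 → 3 := FormBoundedness.FormBounded.exists_representation
  tfae_have 3 → 4 := by
    rintro ⟨Γ, γ, h, rfl⟩
    exact h.exists_isConvolution
  tfae_have 4 → 3 := by
    rintro ⟨G, g, h, hG, hg⟩
    exact ⟨_, _, h.half, FormBoundedness.eq_of_isConvolution h hG hg⟩
  tfae_have 3 → 1 := by
    rintro ⟨Γ, γ, h, rfl⟩
    exact h.infinitesimallyFormBounded
  tfae_finish
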